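/- Let $\mathbb{D}$ be the open unit disc of $\mathbb{C}$ and $dA=\frac1\pi\,dx\,dy$ the normalized area measure on $\mathbb{D}$. For a nondegenerate arc $I\subseteq\partial\mathbb{D}$ (the whole circle is allowed) let $|I|=\frac1{2\pi}\int_I|d\zeta|\in(0,1]$ be its normalized length and $S(I)=\{r\zeta\in\mathbb{D}:\ 1-|I|\le r<1,\ \zeta\in I\}$ its Carleson square. Let $0<p<\infty$, $0<q<\infty$, and let $\mu$ be a positive Borel measure on $\mathbb{D}$. Let - $\mathcal{D}^p_{p-1}$ be the space of all analytic functions $f$ on $\mathbb{D}$ with $\|f\|_{\mathcal{D}^p_{p-1}}=\Big(|f(0)|^p+\int_{\mathbb{D}}|f'(z)|^p(1-|z|^2)^{p-1}\,dA(z)\Big)^{1/p}<\infty$; - $A^p_{q-1}$ be the weighted Bergman space of all analytic functions $f$ on $\mathbb{D}$ with $\|f\|_{A^p_{q-1}}=\Big(q\int_{\mathbb{D}}|f(z)|^p(1-|z|^2)^{q-1}\,dA(z)\Big)^{1/p}<\infty$; - $T_{p,q}(\mu)$ be the tent space of all $\mu$-measurable functions $f$ on $\mathbb{D}$ with $\|f\|_{T_{p,q}(\mu)}=\Big(\sup_{I\subseteq\partial\mathbb{D}}\frac1{|I|^q}\int_{S(I)}|f(z)|^p\,d\mu(z)\Big)^{1/p}<\infty$.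 An inclusion $X\to Y$ between two of these spaces (or into $L^p(\mu)$) is called bounded if every $f\in X$ belongs to $Y$ and there is a constant $C<\infty$ with $\|f\|_Y\le C\|f\|_X$ for all $f\in X$. Then the following statements are equivalent: 1. the inclusion $\mathcal{D}^p_{p-1}\to T_{p,q}(\mu)$ is bounded; 2. $\mu$ is a $(q+1)$-Carleson measure, that is, $\sup_{I\subseteq\partial\mathbb{D}}\frac{\mu(S(I))}{|I|^{q+1}}<\infty$; 3. the inclusion $A^p_{q-1}\to L^p(\mu)$ is bounded. -/

import Mathlib

open MeasureTheory
open scoped ENNReal NNReal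

noncomputable section

/-- The open unit disc `𝔻` of the complex plane. -/
abbrev unitDisc : Set ℂ := Metric.ball (0 : ℂ) 1

/-- The normalized area measure `dA = (1/π) dx dy` on the unit disc
(as a measure on `ℂ` that vanishes outside of the disc). -/
def discArea : Measure ℂ :=
  ENNReal.ofReal (1 / Real.pi) • (volume : Measure ℂ).restrict unitDisc

/-- A nondegenerate closed arc of the unit circle, given by an interval `[left, right]` of
arguments, of length at most `2π`; the whole circle is allowed. (An arc without one or both of its
endpoints has the same length as its closure and a smaller Carleson square, so that suprema over
all arcs and over the closed ones agree.) -/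
structure CircleArc where
  left : ℝ
  right : ℝ
  left_lt_right : left < right
  right_le : right ≤ left + 2 * Real.pi

namespace CircleArc

/-- The arc as a set of points of the unit circle. -/
def carrier (I : CircleArc) : Set ℂ :=
  (fun t : ℝ => Complex.exp (t * Complex.I)) '' Set.Icc I.left I.right

/-- The normalized length `|I| = (1/2π) ∫_I |dζ|`, an element of `(0, 1]`. -/
def length (I : CircleArc) : ℝ := (I.right - I.left) / (2 * Real.pi)

/-- The Carleson square `S(I) = {rζ ∈ 𝔻 : 1 - |I| ≤ r < 1, ζ ∈ I}`. -/
def carlesonSquare (I : CircleArc) : Set unitDisc :=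
  {z | ∃ r : ℝ, ∃ ζ ∈ I.carrier, 1 - I.length ≤ r ∧ r < 1 ∧ (z : ℂ) = r * ζ}

end CircleArc

/-- `‖μ‖_s = sup_I μ(S(I)) / |I|^s`. -/
def carlesonNorm (s : ℝ) (μ : Measure unitDisc) : ℝ≥0∞ :=
  ⨆ I : CircleArc, μ I.carlesonSquare / ENNReal.ofReal (I.length ^ s)

/-- `μ` is an `s`-Carleson measure. -/
def IsCarlesonMeasure (s : ℝ) (μ : Measure unitDisc) : Prop :=
  carlesonNorm s μ < ∞

/-- `‖f‖ = (|f(0)|^p + ∫_𝔻 |f'(z)|^p (1 - |z|²)^(p-1) dA(z))^(1/p)`. -/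
def dirichletNorm (p : ℝ) (f : ℂ → ℂ) : ℝ≥0∞ :=
  (‖f 0‖ₑ ^ p +
    ∫⁻ z, ‖deriv f z‖ₑ ^ p * ENNReal.ofReal ((1 - ‖z‖ ^ 2) ^ (p - 1)) ∂discArea) ^ (1 / p)

/-- The Dirichlet type space `𝓓^p_{p-1}`: functions analytic in the disc with finite norm.
(Only the values in the disc matter; a function on `𝔻` is represented by any extension to `ℂ`.) -/
def dirichletSpace (p : ℝ) : Set (ℂ → ℂ) :=
  {f | DifferentiableOn ℂ f unitDisc ∧ dirichletNorm p f < ∞}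

/-- `‖f‖ = (∫_𝔻 |f(z)|^p (α+1) (1 - |z|²)^α dA(z))^(1/p)`. -/
def bergmanNorm (p α : ℝ) (f : ℂ → ℂ) : ℝ≥0∞ :=
  (∫⁻ z, ‖f z‖ₑ ^ p * ENNReal.ofReal ((α + 1) * (1 - ‖z‖ ^ 2) ^ α) ∂discArea) ^ (1 / p)

/-- The weighted Bergman space `A^p_α`. -/
def bergmanSpace (p α : ℝ) : Set (ℂ → ℂ) :=
  {f | DifferentiableOn ℂ f unitDisc ∧ bergmanNorm p α f < ∞}

/-- `‖f‖ = (sup_I |I|^(-q) ∫_{S(I)} |f|^p dμ)^(1/p)`. -/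
def tentNorm (p q : ℝ) (μ : Measure unitDisc) (f : unitDisc → ℂ) : ℝ≥0∞ :=
  (⨆ I : CircleArc,
    (∫⁻ z in I.carlesonSquare, ‖f z‖ₑ ^ p ∂μ) / ENNReal.ofReal (I.length ^ q)) ^ (1 / p)

/-- The tent space `T_{p,q}(μ)`. -/
def tentSpace (p q : ℝ) (μ : Measure unitDisc) : Set (unitDisc → ℂ) :=
  {f | AEStronglyMeasurable f μ ∧ tentNorm p q μ f < ∞}

/-- The inclusion `f ↦ f|_𝔻` maps the space `X` of functions analytic in the disc, with
(quasi-)norm `normX`, boundedly into the space `Y` of functions on the disc, with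
(quasi-)norm `normY`. -/
def IsBoundedInclusion (X : Set (ℂ → ℂ)) (normX : (ℂ → ℂ) → ℝ≥0∞)
    (Y : Set (unitDisc → ℂ)) (normY : (unitDisc → ℂ) → ℝ≥0∞) : Prop :=
  ∃ C : ℝ≥0, ∀ f ∈ X, unitDisc.domRestrict f ∈ Y ∧ normY (unitDisc.domRestrict f) ≤ C * normX f

end

/-! The Carleson condition is the hub: each of the two embeddings is proved equivalent to it, with
one argument for all `p > 0`.

Sufficiency. For analytic `g`, `|g|^p` has a sub-mean value property up to a constant. Apply it to
`f'` on discs centred along the radius to `z`, with radii proportional to the distance to the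
circle, and integrate the resulting derivative bound along that radius. This bounds `|f z|^p` by `|f
0|^p` plus `(1 - |z|)^(-ε)` times the integral of `|f' w|^p (1 - |w|)^(p-2+ε)` over `shadowRegion z`
(`exists_enorm_rpow_le_add_lintegral_shadowRegion`). Integrate over `S(I)` and exchange the
integrals. For fixed `w`, the relevant `z` lie both in `S(I)` and in a square of side at most `8(1 -
|w|)`. A `(q+1)`-Carleson measure integrates `(1 - |z|)^(-ε)` over a square of side `ℓ` to at most a
constant times `ℓ^(q+1-ε)` when `ε < q`. Using the smaller of the two squares gives `|I|^q (1 -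
|w|)^(1-ε)`, and the weight on `|f'|^p` becomes exactly `(1 - |w|)^(p-1)`. The Bergman embedding
follows in the same way, applying the sub-mean value property to `f` itself.

Necessity. Test on `(1 - conj a * z)^(-n)`, where `a` points at the midpoint of `I` and `1 - |a| =
|I| / 2`. On `S(I)` this function has modulus at least `(5|I|)^(-n)`, while the Forelli-Rudin
estimate controls its norms for large `n`. -/

/-! ### Sub-mean value estimates for powers of analytic functions. -/

/-- Used to exchange comparable weights, such as `1 - ‖w‖` and `1 - ‖w‖ ^ 2`, whose exponents may
have either sign. -/
theorem Real.rpow_le_rpow_abs_mul_rpow {a b K : ℝ} (s : ℝ) (ha : 0 < a) (hb : 0 < b) (hK : 0 < K)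
    (hab : a ≤ K * b) (hba : b ≤ K * a) : a ^ s ≤ K ^ |s| * b ^ s := by
  rcases le_total 0 s with hs | hs
  · rw [abs_of_nonneg hs, ← Real.mul_rpow hK.le hb.le]
    exact Real.rpow_le_rpow ha.le hab hs
  · have h : b / K ≤ a := by rwa [div_le_iff₀' hK]
    calc a ^ s ≤ (b / K) ^ s := Real.rpow_le_rpow_of_nonpos (by positivity) h hs
      _ = K ^ |s| * b ^ s := by
        rw [Real.div_rpow hb.le hK.le, abs_of_nonpos hs, Real.rpow_neg hK.le]
        field_simp

theorem enorm_rpow_eq_ofReal {p : ℝ} (hp : 0 ≤ p) (z : ℂ) :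
    ‖z‖ₑ ^ p = ENNReal.ofReal (‖z‖ ^ p) := by
  rw [← ofReal_norm, ENNReal.ofReal_rpow_of_nonneg (norm_nonneg z) hp]

/-- An analytic function is comparable to its value at a point `v` on a disc around `v` whose
radius is a fixed proportion of that of a disc on which it is bounded by a multiple of that
value. -/
theorem half_norm_le_norm_of_norm_le {g : ℂ → ℂ} {v w : ℂ} {d L : ℝ} (hd : 0 < d) (hL : 0 ≤ L)
    (hg : DifferentiableOn ℂ g (Metric.ball v d))
    (hb : ∀ z ∈ Metric.ball v d, ‖g z‖ ≤ L * ‖g v‖) (hw : dist w v ≤ d / (2 * (L + 1))) :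
    ‖g v‖ / 2 ≤ ‖g w‖ := by
  have hmaps : Set.MapsTo g (Metric.ball v d) (Metric.closedBall (g v) ((L + 1) * ‖g v‖)) := by
    intro z hz
    rw [mem_closedBall_iff_norm]
    linarith [norm_sub_le (g z) (g v), hb z hz]
  have hwd : w ∈ Metric.ball v d := by
    rw [Metric.mem_ball]
    refine hw.trans_lt ?_
    rw [div_lt_iff₀ (by positivity)]
    nlinarith
  -- By the Schwarz lemma `g` varies by at most `(L + 1) * ‖g v‖ / d` per unit of distance from `v`.
  have h1 := Complex.dist_le_div_mul_dist_of_mapsTo_ball hg hmaps hwd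
  have h2 : (L + 1) * ‖g v‖ / d * dist w v ≤ ‖g v‖ / 2 := by
    calc (L + 1) * ‖g v‖ / d * dist w v
        ≤ (L + 1) * ‖g v‖ / d * (d / (2 * (L + 1))) := by gcongr
      _ = ‖g v‖ / 2 := by field_simp
  have h3 : ‖g v‖ - ‖g w‖ ≤ dist (g w) (g v) := by
    rw [dist_comm, dist_eq_norm]; exact norm_sub_norm_le _ _
  linarith

/-- Sub-mean value property, up to a constant, of `|g|^p` for an analytic function `g`. -/
theorem exists_enorm_rpow_mul_sq_le_lintegral {p : ℝ} (hp : 0 < p) :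
    ∃ C : ℝ, 0 < C ∧ ∀ (g : ℂ → ℂ) (u : ℂ) (ρ : ℝ), 0 < ρ →
      DifferentiableOn ℂ g (Metric.closedBall u ρ) →
      ‖g u‖ₑ ^ p * ENNReal.ofReal (ρ ^ 2) ≤
        ENNReal.ofReal C * ∫⁻ w in Metric.ball u ρ, ‖g w‖ₑ ^ p := by
  set L : ℝ := 2 ^ (2 / p) with hL
  have hL0 : 0 < L := by positivity
  set c : ℝ := 1 / (4 * (L + 1)) with hc
  have hc0 : 0 < c := by positivity
  have hc1 : c ≤ 1 := by rw [hc, div_le_one (by positivity)]; linarith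
  refine ⟨2 ^ p / (Real.pi * c ^ 2), by positivity, fun g u ρ hρ hg => ?_⟩
  rcases eq_or_ne (g u) 0 with h0 | h0
  · simp [h0, ENNReal.zero_rpow_of_pos hp]
  have h2p : 0 < 2 / p := by positivity
  -- Maximizing `|g|` against a power of the distance to the boundary circle makes `g` nearly
  -- constant around the maximizer `v`: halving that distance costs only the factor `L = 2 ^ (2 /
  -- p)`. The exponent `2 / p` turns into the area factor `d ^ 2` after taking `p`-th powers.
  obtain ⟨v, hv, hmax⟩ := (isCompact_closedBall u ρ).exists_isMaxOn
    ⟨u, Metric.mem_closedBall_self hρ.le⟩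
    (f := fun w => (ρ - dist w u) ^ (2 / p) * ‖g w‖) (by
      refine ContinuousOn.mul (ContinuousOn.rpow_const (by fun_prop) fun _ _ => Or.inr h2p.le) ?_
      exact hg.continuousOn.norm)
  have hmax' : ∀ w ∈ Metric.closedBall u ρ,
      (ρ - dist w u) ^ (2 / p) * ‖g w‖ ≤ (ρ - dist v u) ^ (2 / p) * ‖g v‖ := fun w hw => hmax hw
  have hu := hmax' u (Metric.mem_closedBall_self hρ.le)
  rw [dist_self, sub_zero] at hu
  have hpos : 0 < (ρ - dist v u) ^ (2 / p) * ‖g v‖ :=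
    lt_of_lt_of_le (mul_pos (by positivity) (norm_pos_iff.2 h0)) hu
  set d := ρ - dist v u with hd
  have hd0 : 0 < d := by
    rcases (sub_nonneg.2 (Metric.mem_closedBall.1 hv)).lt_or_eq with h | h
    · exact h
    · rw [hd, ← h, Real.zero_rpow h2p.ne', zero_mul] at hpos
      exact absurd hpos (lt_irrefl _)
  have hball : ∀ w, dist w v < d → w ∈ Metric.ball u ρ := by
    intro w hw
    rw [Metric.mem_ball]
    linarith [dist_triangle w v u]
  have hbound : ∀ z ∈ Metric.ball v (d / 2), ‖g z‖ ≤ L * ‖g v‖ := by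
    intro z hz
    rw [Metric.mem_ball] at hz
    have hz1 := hmax' z (Metric.ball_subset_closedBall (hball z (by linarith)))
    have hz2 : d / 2 ≤ ρ - dist z u := by linarith [dist_triangle z v u]
    have hz3 : (d / 2) ^ (2 / p) * ‖g z‖ ≤ d ^ (2 / p) * ‖g v‖ := by
      refine le_trans ?_ hz1
      gcongr
    rw [Real.div_rpow hd0.le zero_le_two, ← hL] at hz3
    have hdp : 0 < d ^ (2 / p) := by positivity
    have : d ^ (2 / p) * ‖g z‖ ≤ d ^ (2 / p) * (L * ‖g v‖) := by
      have := mul_le_mul_of_nonneg_left hz3 hL0.le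
      calc d ^ (2 / p) * ‖g z‖ = L * (d ^ (2 / p) / L * ‖g z‖) := by field_simp
        _ ≤ L * (d ^ (2 / p) * ‖g v‖) := this
        _ = _ := by ring
    exact le_of_mul_le_mul_left this hdp
  have hlow : ∀ w ∈ Metric.ball v (c * d), ‖g v‖ / 2 ≤ ‖g w‖ := by
    intro w hw
    refine half_norm_le_norm_of_norm_le (half_pos hd0) hL0.le
      (hg.mono fun z hz => Metric.ball_subset_closedBall (hball z ?_)) hbound ?_
    · rw [Metric.mem_ball] at hz; linarith
    · rw [Metric.mem_ball] at hw
      refine hw.le.trans (le_of_eq ?_)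
      rw [hc]; field_simp; ring
  have hsub : Metric.ball v (c * d) ⊆ Metric.ball u ρ := fun w hw =>
    hball w (lt_of_lt_of_le hw (by nlinarith))
  have hint : ENNReal.ofReal ((‖g v‖ / 2) ^ p) * (ENNReal.ofReal (c * d) ^ 2 * NNReal.pi) ≤
      ∫⁻ w in Metric.ball u ρ, ‖g w‖ₑ ^ p := by
    rw [← Complex.volume_ball v (c * d), ← setLIntegral_const]
    refine (setLIntegral_mono' measurableSet_ball fun w hw => ?_).trans
      (lintegral_mono_set hsub)
    rw [enorm_rpow_eq_ofReal hp.le]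
    exact ENNReal.ofReal_le_ofReal (Real.rpow_le_rpow (by positivity) (hlow w hw) hp.le)
  refine le_trans ?_ (mul_le_mul_right hint _)
  have hpi : (NNReal.pi : ℝ≥0∞) = ENNReal.ofReal Real.pi := by
    rw [← NNReal.coe_real_pi, ENNReal.ofReal_coe_nnreal]
  rw [enorm_rpow_eq_ofReal hp.le, hpi, ← ENNReal.ofReal_pow (by positivity),
    ← ENNReal.ofReal_mul (by positivity), ← ENNReal.ofReal_mul (by positivity),
    ← ENNReal.ofReal_mul (by positivity), ← ENNReal.ofReal_mul (by positivity)]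
  refine ENNReal.ofReal_le_ofReal ?_
  have hup := Real.rpow_le_rpow (by positivity) hu hp.le
  rw [Real.mul_rpow (by positivity) (norm_nonneg _), Real.mul_rpow (by positivity) (norm_nonneg _),
    ← Real.rpow_mul hρ.le, ← Real.rpow_mul hd0.le, div_mul_cancel₀ _ hp.ne', Real.rpow_two,
    Real.rpow_two] at hup
  calc ‖g u‖ ^ p * ρ ^ 2 ≤ d ^ 2 * ‖g v‖ ^ p := by linarith
    _ = _ := by
      rw [Real.div_rpow (norm_nonneg _) zero_le_two]
      field_simp

theorem setLIntegral_discArea {s : Set ℂ} (hs : MeasurableSet s) (hsub : s ⊆ unitDisc)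
    (F : ℂ → ℝ≥0∞) :
    ∫⁻ w in s, F w ∂discArea = ENNReal.ofReal (1 / Real.pi) * ∫⁻ w in s, F w := by
  rw [discArea, Measure.restrict_smul, lintegral_smul_measure, Measure.restrict_restrict hs,
    Set.inter_eq_left.2 hsub, smul_eq_mul]

/-- Weighted version of the sub-mean value property on the discs of a Whitney covering. -/
theorem exists_enorm_rpow_le_lintegral_discArea {p : ℝ} (hp : 0 < p) (b : ℝ) :
    ∃ C : ℝ, 0 < C ∧ ∀ g : ℂ → ℂ, DifferentiableOn ℂ g unitDisc → ∀ u ∈ unitDisc,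
      ‖g u‖ₑ ^ p ≤ ENNReal.ofReal (C * (1 - ‖u‖) ^ (-2 - b)) *
        ∫⁻ w in Metric.ball u ((1 - ‖u‖) / 2),
          ‖g w‖ₑ ^ p * ENNReal.ofReal ((1 - ‖w‖) ^ b) ∂discArea := by
  obtain ⟨C, hC, h⟩ := exists_enorm_rpow_mul_sq_le_lintegral hp
  refine ⟨4 * C * 2 ^ |b| * Real.pi, by positivity, fun g hg u hu => ?_⟩
  rw [mem_ball_zero_iff] at hu
  set x := 1 - ‖u‖ with hx
  have hx0 : 0 < x := by linarith
  have hsub : Metric.closedBall u (x / 2) ⊆ unitDisc := by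
    intro w hw
    rw [mem_closedBall_iff_norm] at hw
    rw [mem_ball_zero_iff]
    linarith [norm_sub_norm_le w u]
  have h1 := h g u (x / 2) (by positivity) (hg.mono hsub)
  rw [setLIntegral_discArea measurableSet_ball (Metric.ball_subset_closedBall.trans hsub)]
  set A := ∫⁻ w in Metric.ball u (x / 2), ‖g w‖ₑ ^ p
  set B := ∫⁻ w in Metric.ball u (x / 2), ‖g w‖ₑ ^ p * ENNReal.ofReal ((1 - ‖w‖) ^ b)
  -- On the disc of radius `x / 2` around `u`, `1 - ‖w‖` lies between `x / 2` and `3 * x / 2`, so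
  -- the weight is constant up to the factor `2 ^ |b|`.
  have h2 : ENNReal.ofReal (x ^ b) * A ≤ ENNReal.ofReal (2 ^ |b|) * B := by
    rw [← lintegral_const_mul' _ _ ENNReal.ofReal_ne_top,
      ← lintegral_const_mul' _ _ ENNReal.ofReal_ne_top]
    refine setLIntegral_mono' measurableSet_ball fun w hw => ?_
    rw [mem_ball_iff_norm] at hw
    have e1 := norm_sub_norm_le w u
    have e2 := norm_sub_norm_le u w
    rw [norm_sub_rev] at e2
    have hw0 : 0 < 1 - ‖w‖ := by linarith
    rw [mul_left_comm, mul_comm, ← ENNReal.ofReal_mul (by positivity)]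
    exact mul_le_mul_right (ENNReal.ofReal_le_ofReal
      (Real.rpow_le_rpow_abs_mul_rpow b hx0 hw0 two_pos (by linarith) (by linarith))) _
  have hy : 0 < (x / 2) ^ 2 * x ^ b := by positivity
  calc ‖g u‖ₑ ^ p
      = ENNReal.ofReal (((x / 2) ^ 2 * x ^ b)⁻¹) * (ENNReal.ofReal (x ^ b) *
        (‖g u‖ₑ ^ p * ENNReal.ofReal ((x / 2) ^ 2))) := by
        rw [mul_comm (‖g u‖ₑ ^ p), ← mul_assoc, ← mul_assoc,
          mul_assoc (ENNReal.ofReal (((x / 2) ^ 2 * x ^ b)⁻¹)), ← ENNReal.ofReal_mul (by positivity),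
          ← ENNReal.ofReal_mul (by positivity), mul_comm (x ^ b), inv_mul_cancel₀ hy.ne',
          ENNReal.ofReal_one, one_mul]
    _ ≤ ENNReal.ofReal (((x / 2) ^ 2 * x ^ b)⁻¹) * (ENNReal.ofReal (x ^ b) *
        (ENNReal.ofReal C * A)) := by gcongr
    _ = ENNReal.ofReal (((x / 2) ^ 2 * x ^ b)⁻¹) * (ENNReal.ofReal C *
        (ENNReal.ofReal (x ^ b) * A)) := by rw [mul_left_comm (ENNReal.ofReal C)]
    _ ≤ ENNReal.ofReal (((x / 2) ^ 2 * x ^ b)⁻¹) * (ENNReal.ofReal C *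
        (ENNReal.ofReal (2 ^ |b|) * B)) := by gcongr
    _ = _ := by
        rw [← mul_assoc, ← mul_assoc, ← mul_assoc, ← ENNReal.ofReal_mul (by positivity),
          ← ENNReal.ofReal_mul (by positivity), ← ENNReal.ofReal_mul (by positivity)]
        congr 2
        rw [Real.rpow_sub hx0, Real.rpow_neg hx0.le, Real.rpow_two]
        field_simp
        norm_num

/-! ### Radial growth controlled by area integrals of the derivative. -/

/-- The set of points of the disc whose (wide) Stolz-type shadow contains `z`. -/
def shadowRegion (z : ℂ) : Set ℂ := {w | dist w z ≤ 3 * (1 - ‖w‖)}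

theorem measurableSet_shadowRegion (z : ℂ) : MeasurableSet (shadowRegion z) :=
  (isClosed_le (by fun_prop) (by fun_prop)).measurableSet

/-- With `x = 1 - t * ‖z‖`, a point `w` of the disc satisfies `dist w z ≤ x / 2 + (1 - t) * ‖z‖ ≤ 3
* x / 2` and `1 - ‖w‖ ≥ x / 2`; this is where the aperture `3` comes from. -/
theorem ball_subset_shadowRegion {z : ℂ} {t : ℝ} (ht : t ∈ Set.Icc (0 : ℝ) 1) (hz : ‖z‖ < 1) :
    Metric.ball (t * z) ((1 - ‖t * z‖) / 2) ⊆ shadowRegion z := by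
  intro w hw
  rw [mem_ball_iff_norm] at hw
  have e1 : ‖(t : ℂ) * z‖ = t * ‖z‖ := by
    rw [norm_mul, Complex.norm_real, Real.norm_of_nonneg ht.1]
  have e2 := norm_sub_norm_le w (t * z)
  have e3 : dist w z ≤ ‖w - t * z‖ + (1 - t) * ‖z‖ := by
    have : w - z = (w - t * z) - ((1 - t : ℝ) : ℂ) * z := by push_cast; ring
    rw [dist_eq_norm, this]
    refine (norm_sub_le _ _).trans (le_of_eq ?_)
    rw [norm_mul (((1 - t : ℝ) : ℂ)), Complex.norm_real, Real.norm_of_nonneg (by linarith [ht.2])]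
  show dist w z ≤ 3 * (1 - ‖w‖)
  rw [e1] at hw e2
  nlinarith [ht.1, ht.2, norm_nonneg z]

theorem add_rpow_le_two_rpow_mul {p x y : ℝ} (hp : 0 ≤ p) (hx : 0 ≤ x) (hy : 0 ≤ y) :
    (x + y) ^ p ≤ 2 ^ p * x ^ p + 2 ^ p * y ^ p := by
  have h1 : 0 ≤ 2 ^ p * x ^ p := by positivity
  have h2 : 0 ≤ 2 ^ p * y ^ p := by positivity
  rcases le_total x y with h | h
  · calc (x + y) ^ p ≤ (2 * y) ^ p := by gcongr; linarith
      _ = 2 ^ p * y ^ p := Real.mul_rpow zero_le_two hy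
      _ ≤ _ := by linarith
  · calc (x + y) ^ p ≤ (2 * x) ^ p := by gcongr; linarith
      _ = 2 ^ p * x ^ p := Real.mul_rpow zero_le_two hx
      _ ≤ _ := by linarith

/-- Integration of a radial growth bound of the derivative. -/
theorem norm_sub_le_of_norm_deriv_le {f : ℂ → ℂ} (hf : DifferentiableOn ℂ f unitDisc) {z : ℂ}
    (hz : ‖z‖ < 1) {K s : ℝ} (hK : 0 ≤ K) (hs : 0 < s)
    (h : ∀ t ∈ Set.Icc (0 : ℝ) 1, ‖deriv f (t * z)‖ ≤ K * (1 - t * ‖z‖) ^ (-s - 1)) :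
    ‖f z - f 0‖ ≤ K / s * (1 - ‖z‖) ^ (-s) := by
  have hpos : ∀ t ∈ Set.Icc (0 : ℝ) 1, 0 < 1 - t * ‖z‖ := fun t ht => by
    nlinarith [ht.1, ht.2, norm_nonneg z]
  have hmem : ∀ t ∈ Set.Icc (0 : ℝ) 1, (t : ℂ) * z ∈ unitDisc := fun t ht => by
    rw [mem_ball_zero_iff, norm_mul, Complex.norm_real, Real.norm_of_nonneg ht.1]
    linarith [hpos t ht]
  have hderiv : ∀ t ∈ Set.Icc (0 : ℝ) 1,
      HasDerivAt (fun t : ℝ => f (t * z) - f 0) (deriv f (t * z) * z) t := fun t ht => by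
    have h1 : HasDerivAt f (deriv f (t * z)) (t * z) :=
      (hf.differentiableAt (Metric.isOpen_ball.mem_nhds (hmem t ht))).hasDerivAt
    have h2 : HasDerivAt (fun t : ℝ => (t : ℂ) * z) z t := by
      simpa using (Complex.ofRealCLM.hasDerivAt (x := t)).mul_const z
    simpa using (h1.comp_of_eq t h2 rfl).sub_const (f 0)
  have hB : ∀ t ∈ Set.Icc (0 : ℝ) 1, HasDerivAt (fun t : ℝ => K / s * (1 - t * ‖z‖) ^ (-s))
      (K * (1 - t * ‖z‖) ^ (-s - 1) * ‖z‖) t := fun t ht => by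
    have h1 : HasDerivAt (fun t : ℝ => 1 - t * ‖z‖) (-‖z‖) t := by
      simpa using ((hasDerivAt_id t).mul_const ‖z‖).const_sub 1
    refine ((h1.rpow_const (p := -s) (Or.inl (hpos t ht).ne')).const_mul (K / s)).congr_deriv ?_
    field_simp
  have := image_norm_le_of_norm_deriv_right_le_deriv_boundary'
    (f := fun t : ℝ => f (t * z) - f 0) (f' := fun t : ℝ => deriv f (t * z) * z) (a := 0) (b := 1)
    (fun t ht => (hderiv t ht).continuousAt.continuousWithinAt)
    (fun t ht => (hderiv t (Set.Ico_subset_Icc_self ht)).hasDerivWithinAt)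
    (B := fun t : ℝ => K / s * (1 - t * ‖z‖) ^ (-s))
    (B' := fun t : ℝ => K * (1 - t * ‖z‖) ^ (-s - 1) * ‖z‖)
    (by simp; positivity)
    (fun t ht => (hB t ht).continuousAt.continuousWithinAt)
    (fun t ht => (hB t (Set.Ico_subset_Icc_self ht)).hasDerivWithinAt)
    (fun t ht => by
      rw [norm_mul]
      exact mul_le_mul_of_nonneg_right (h t (Set.Ico_subset_Icc_self ht)) (norm_nonneg z))
    (Set.right_mem_Icc.2 zero_le_one)
  simpa using this

/-- Pointwise control of `|f|^p` by an area integral of `|f'|^p` over a nontangential-type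
region, for all `p > 0`. -/
theorem exists_enorm_rpow_le_add_lintegral_shadowRegion {p ε : ℝ} (hp : 0 < p) (hε : 0 < ε) :
    ∃ C : ℝ, 0 < C ∧ ∀ f : ℂ → ℂ, DifferentiableOn ℂ f unitDisc → ∀ z ∈ unitDisc,
      ‖f z‖ₑ ^ p ≤ ENNReal.ofReal C * ‖f 0‖ₑ ^ p +
        ENNReal.ofReal C * (ENNReal.ofReal ((1 - ‖z‖) ^ (-ε)) *
        ∫⁻ w in shadowRegion z,
          ‖deriv f w‖ₑ ^ p * ENNReal.ofReal ((1 - ‖w‖) ^ (p - 2 + ε)) ∂discArea) := by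
  obtain ⟨C, hC, h⟩ := exists_enorm_rpow_le_lintegral_discArea hp (p - 2 + ε)
  have hM : 0 < 2 ^ p * max 1 (C * (p / ε) ^ p) := by positivity
  refine ⟨2 ^ p * max 1 (C * (p / ε) ^ p), hM, fun f hf z hz => ?_⟩
  rw [mem_ball_zero_iff] at hz
  set B := ∫⁻ w in shadowRegion z,
    ‖deriv f w‖ₑ ^ p * ENNReal.ofReal ((1 - ‖w‖) ^ (p - 2 + ε)) ∂discArea
  have hz0 : 0 < 1 - ‖z‖ := by linarith
  rcases eq_or_ne B ∞ with hB | hB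
  · have h1 : ENNReal.ofReal ((1 - ‖z‖) ^ (-ε)) ≠ 0 := by
      rw [Ne, ENNReal.ofReal_eq_zero, not_le]; positivity
    rw [hB, ENNReal.mul_top h1, ENNReal.mul_top (by simpa using hM), add_top]
    exact le_top
  set b := B.toReal
  have hb : 0 ≤ b := ENNReal.toReal_nonneg
  have hBb : B = ENNReal.ofReal b := (ENNReal.ofReal_toReal hB).symm
  -- All the discs centred along the radius lie in the one region `shadowRegion z`, so the same `b`
  -- bounds the derivative at each of its points.
  have key : ∀ t ∈ Set.Icc (0 : ℝ) 1,
      ‖deriv f (t * z)‖ ≤ (C * b) ^ (1 / p) * (1 - t * ‖z‖) ^ (-(ε / p) - 1) := by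
    intro t ht
    have e1 : ‖(t : ℂ) * z‖ = t * ‖z‖ := by
      rw [norm_mul, Complex.norm_real, Real.norm_of_nonneg ht.1]
    have hx : 0 < 1 - t * ‖z‖ := by nlinarith [ht.1, ht.2, norm_nonneg z]
    have h1 := (h (deriv f) (hf.deriv Metric.isOpen_ball) (t * z)
      (by rw [mem_ball_zero_iff, e1]; linarith)).trans
      (mul_le_mul_right (lintegral_mono_set (ball_subset_shadowRegion ht hz)) _)
    change _ ≤ _ * B at h1
    rw [hBb, e1, enorm_rpow_eq_ofReal hp.le, ← ENNReal.ofReal_mul (by positivity),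
      ENNReal.ofReal_le_ofReal_iff (by positivity)] at h1
    have h2 := Real.rpow_le_rpow (by positivity) h1 (one_div_nonneg.2 hp.le)
    rw [← Real.rpow_mul (norm_nonneg _), mul_one_div_cancel hp.ne', Real.rpow_one, mul_right_comm,
      Real.mul_rpow (by positivity) (by positivity), ← Real.rpow_mul hx.le] at h2
    convert h2 using 3
    field_simp
    ring
  have h3 := norm_sub_le_of_norm_deriv_le hf hz (by positivity) (div_pos hε hp) key
  have h4 : ‖f z‖ ≤ ‖f 0‖ + (C * b) ^ (1 / p) / (ε / p) * (1 - ‖z‖) ^ (-(ε / p)) := by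
    linarith [norm_sub_norm_le (f z) (f 0)]
  have h5 := (Real.rpow_le_rpow (norm_nonneg _) h4 hp.le).trans
    (add_rpow_le_two_rpow_mul hp.le (norm_nonneg _) (by positivity))
  have h6 : ((C * b) ^ (1 / p) / (ε / p) * (1 - ‖z‖) ^ (-(ε / p))) ^ p =
      C * (p / ε) ^ p * ((1 - ‖z‖) ^ (-ε) * b) := by
    rw [Real.mul_rpow (by positivity) (by positivity), Real.div_rpow (by positivity)
      (by positivity), ← Real.rpow_mul (by positivity), ← Real.rpow_mul hz0.le,
      one_div_mul_cancel hp.ne', Real.rpow_one, Real.div_rpow hε.le hp.le,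
      Real.div_rpow hp.le hε.le, neg_mul, div_mul_cancel₀ _ hp.ne']
    field_simp
  rw [h6] at h5
  rw [hBb, enorm_rpow_eq_ofReal hp.le, enorm_rpow_eq_ofReal hp.le,
    ← ENNReal.ofReal_mul (by positivity), ← ENNReal.ofReal_mul (by positivity),
    ← ENNReal.ofReal_mul (by positivity), ← ENNReal.ofReal_add (by positivity) (by positivity)]
  refine ENNReal.ofReal_le_ofReal (h5.trans ?_)
  have e1 : 2 ^ p * 1 ≤ 2 ^ p * max 1 (C * (p / ε) ^ p) := by
    gcongr
    exact le_max_left _ _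
  have e2 : 2 ^ p * (C * (p / ε) ^ p) ≤ 2 ^ p * max 1 (C * (p / ε) ^ p) := by
    gcongr
    exact le_max_right _ _
  rw [mul_one] at e1
  rw [← mul_assoc (2 ^ p) (C * (p / ε) ^ p)]
  gcongr

/-! ### Geometry of arcs and Carleson squares. -/

namespace CircleArc

theorem length_pos (I : CircleArc) : 0 < I.length :=
  div_pos (sub_pos.2 I.left_lt_right) Real.two_pi_pos

theorem length_le_one (I : CircleArc) : I.length ≤ 1 := by
  rw [length, div_le_one Real.two_pi_pos]
  linarith [I.right_le]

theorem right_sub_left (I : CircleArc) : I.right - I.left = 2 * Real.pi * I.length := by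
  rw [length]; field_simp

theorem mem_carlesonSquare_iff (I : CircleArc) (z : unitDisc) :
    z ∈ I.carlesonSquare ↔ 1 - I.length ≤ ‖(z : ℂ)‖ ∧
      ∃ t ∈ Set.Icc I.left I.right, (z : ℂ) = ‖(z : ℂ)‖ * Complex.exp (t * Complex.I) := by
  constructor
  · rintro ⟨r, _, ⟨t, ht, rfl⟩, h1, -, hz⟩
    have hr : 0 ≤ r := by linarith [I.length_le_one]
    have : ‖(z : ℂ)‖ = r := by
      rw [hz, norm_mul, Complex.norm_exp_ofReal_mul_I, mul_one, Complex.norm_real,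
        Real.norm_of_nonneg hr]
    rw [this]
    exact ⟨h1, t, ht, hz⟩
  · rintro ⟨h1, t, ht, hz⟩
    exact ⟨_, _, ⟨t, ht, rfl⟩, h1, mem_ball_zero_iff.1 z.2, hz⟩

/-- The square is the trace on the disc of a compact image of a closed polar rectangle; allowing `r
= 1` adds only points off the open disc. -/
theorem measurableSet_carlesonSquare (I : CircleArc) : MeasurableSet I.carlesonSquare := by
  have hK : IsCompact ((fun x : ℝ × ℝ => (x.1 : ℂ) * Complex.exp (x.2 * Complex.I)) ''
      (Set.Icc (1 - I.length) 1 ×ˢ Set.Icc I.left I.right)) :=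
    (isCompact_Icc.prod isCompact_Icc).image (by fun_prop)
  have : I.carlesonSquare = ((↑) : unitDisc → ℂ) ⁻¹'
      ((fun x : ℝ × ℝ => (x.1 : ℂ) * Complex.exp (x.2 * Complex.I)) ''
      (Set.Icc (1 - I.length) 1 ×ˢ Set.Icc I.left I.right)) := by
    ext z
    constructor
    · rintro ⟨r, _, ⟨t, ht, rfl⟩, h1, h2, hz⟩
      exact ⟨(r, t), ⟨⟨h1, h2.le⟩, ht⟩, hz.symm⟩
    · rintro ⟨⟨r, t⟩, ⟨⟨h1, h2⟩, ht⟩, hz⟩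
      refine ⟨r, _, ⟨t, ht, rfl⟩, h1, h2.lt_of_ne ?_, hz.symm⟩
      rintro rfl
      have hz1 := mem_ball_zero_iff.1 z.2
      rw [← hz] at hz1
      simp [Complex.norm_exp_ofReal_mul_I] at hz1
  rw [this]
  exact (hK.isClosed.preimage continuous_subtype_val).measurableSet

/-- The arc with midpoint `exp (iθ)` and normalized length `ℓ`. -/
noncomputable def centered (θ ℓ : ℝ) (h0 : 0 < ℓ) (h1 : ℓ ≤ 1) : CircleArc where
  left := θ - Real.pi * ℓ
  right := θ + Real.pi * ℓ
  left_lt_right := by nlinarith [Real.pi_pos]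
  right_le := by nlinarith [Real.pi_pos]

theorem length_centered (θ ℓ : ℝ) (h0 : 0 < ℓ) (h1 : ℓ ≤ 1) : (centered θ ℓ h0 h1).length = ℓ := by
  rw [length, centered]
  field_simp
  ring

theorem carlesonSquare_centered_zero_one :
    (centered 0 1 one_pos le_rfl).carlesonSquare = Set.univ := by
  refine Set.eq_univ_of_forall fun z => (mem_carlesonSquare_iff _ z).2 ⟨?_, Complex.arg z, ?_, ?_⟩
  · simp [length_centered]
  · simp only [centered, zero_sub, zero_add, mul_one]
    exact ⟨(Complex.neg_pi_lt_arg _).le, Complex.arg_le_pi _⟩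
  · exact (Complex.norm_mul_exp_arg_mul_I _).symm

/-- The points whose region `shadowRegion` contains `w` lie in a Carleson square of side
comparable to `1 - |w|`. -/
theorem exists_shadow_subset_carlesonSquare {w : ℂ} (hw : ‖w‖ < 1) :
    ∃ J : CircleArc, J.length ≤ 8 * (1 - ‖w‖) ∧
      ∀ z : unitDisc, w ∈ shadowRegion z → z ∈ J.carlesonSquare := by
  set δ := 1 - ‖w‖ with hδ
  have hδ0 : 0 < δ := by linarith
  -- If `8 * δ ≥ 1`, the square over the whole circle, which is the entire disc, already has
  -- admissible length.
  rcases le_or_gt 1 (8 * δ) with h | h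
  · refine ⟨centered 0 1 one_pos le_rfl, ?_, fun z _ => ?_⟩
    · rwa [length_centered]
    · rw [carlesonSquare_centered_zero_one]; trivial
  · refine ⟨centered (Complex.arg w) (8 * δ) (by positivity) h.le, ?_, fun z hz => ?_⟩
    · rw [length_centered]
    · have hz : dist w z ≤ 3 * δ := hz
      -- Rotate so that `w` moves to the positive axis; `arg v` is then the angle between `z` and
      -- `w`.
      set v : ℂ := z * Complex.exp (-(Complex.arg w) * Complex.I) with hv
      have hvz : (z : ℂ) = v * Complex.exp (Complex.arg w * Complex.I) := by
        rw [hv, mul_assoc, ← Complex.exp_add]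
        simp
      have hnv : ‖v‖ = ‖(z : ℂ)‖ := by
        have := congrArg norm hvz
        rw [norm_mul v, Complex.norm_exp_ofReal_mul_I, mul_one] at this
        exact this.symm
      have hvw : ‖v - ‖w‖‖ ≤ 3 * δ := by
        have : (z : ℂ) - w = (v - ‖w‖) * Complex.exp (Complex.arg w * Complex.I) := by
          rw [sub_mul, ← hvz, Complex.norm_mul_exp_arg_mul_I]
        rw [dist_comm, dist_eq_norm, this, norm_mul, Complex.norm_exp_ofReal_mul_I, mul_one] at hz
        exact hz
      have hre : 1 - 4 * δ ≤ v.re := by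
        have := (Complex.abs_re_le_norm _).trans hvw
        rw [Complex.sub_re, Complex.ofReal_re, abs_le] at this
        linarith
      have him : |v.im| ≤ 3 * δ := by
        have := (Complex.abs_im_le_norm _).trans hvw
        rwa [Complex.sub_im, Complex.ofReal_im, sub_zero] at this
      have hn : 1 / 2 ≤ ‖v‖ := by linarith [Complex.re_le_norm v]
      -- Here `|sin (arg v)| = |v.im| / ‖v‖ ≤ 6 * δ`, and Jordan's inequality turns this into `|arg
      -- v| ≤ 3 * π * δ`, well within the half-width of the arc.
      have harg : |Complex.arg v| ≤ 8 * δ * Real.pi := by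
        have h1 := Real.mul_abs_le_abs_sin (x := Complex.arg v)
          (Complex.abs_arg_le_pi_div_two_iff.2 (by linarith))
        rw [Complex.sin_arg, abs_div, abs_norm] at h1
        have h2 : |v.im| / ‖v‖ ≤ 6 * δ := by
          rw [div_le_iff₀ (by linarith)]
          nlinarith
        have h3 := h1.trans h2
        rw [div_mul_eq_mul_div, div_le_iff₀ Real.pi_pos] at h3
        nlinarith [mul_pos hδ0 Real.pi_pos]
      refine (mem_carlesonSquare_iff _ z).2 ⟨?_, Complex.arg w + Complex.arg v, ?_, ?_⟩
      · rw [length_centered, ← hnv]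
        linarith [Complex.re_le_norm v]
      · rw [abs_le] at harg
        simp only [centered, Set.mem_Icc]
        constructor <;> linarith
      · rw [← hnv]
        conv_lhs => rw [hvz, ← Complex.norm_mul_exp_arg_mul_I v]
        rw [mul_assoc, ← Complex.exp_add]
        push_cast
        ring_nf

/-- Every Carleson square has an associated point `a` of the disc. -/
theorem exists_norm_one_sub_conj_mul_le (I : CircleArc) :
    ∃ a : ℂ, ‖a‖ = 1 - I.length / 2 ∧
      ∀ z ∈ I.carlesonSquare, ‖1 - (starRingEnd ℂ) a * z‖ ≤ 5 * I.length := by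
  have hl := I.length_pos
  have hl1 := I.length_le_one
  set θ := (I.left + I.right) / 2 with hθ
  refine ⟨(1 - I.length / 2 : ℝ) * Complex.exp (θ * Complex.I), ?_, fun z hz => ?_⟩
  · rw [norm_mul, Complex.norm_exp_ofReal_mul_I, mul_one, Complex.norm_real, Real.norm_of_nonneg]
    linarith
  · obtain ⟨h1, t, ht, hz⟩ := (I.mem_carlesonSquare_iff z).1 hz
    have hz1 : ‖(z : ℂ)‖ < 1 := mem_ball_zero_iff.1 z.2
    set r := ‖(z : ℂ)‖
    set x := (1 - I.length / 2) * r with hx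
    have hr : 0 ≤ r := norm_nonneg _
    have hx0 : 0 ≤ x := mul_nonneg (by linarith) hr
    have hx1 : x ≤ 1 := by nlinarith
    have e : 1 - (starRingEnd ℂ) ((1 - I.length / 2 : ℝ) * Complex.exp (θ * Complex.I)) * z =
        ((1 - x : ℝ) : ℂ) - x * (Complex.exp (Complex.I * (t - θ : ℝ)) - 1) := by
      rw [hz, map_mul, Complex.conj_ofReal, ← Complex.exp_conj, map_mul, Complex.conj_ofReal,
        Complex.conj_I, hx]
      have : Complex.exp (Complex.I * ((t - θ : ℝ) : ℂ)) =
          Complex.exp (θ * -Complex.I) * Complex.exp (t * Complex.I) := by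
        rw [← Complex.exp_add]; push_cast; ring_nf
      rw [this]
      push_cast
      ring
    rw [e]
    have h2 : ‖Complex.exp (Complex.I * (t - θ : ℝ)) - 1‖ ≤ Real.pi * I.length := by
      refine Real.norm_exp_I_mul_ofReal_sub_one_le.trans ?_
      have := I.right_sub_left
      rw [Real.norm_eq_abs, abs_le, hθ]
      constructor <;> linarith [ht.1, ht.2]
    calc _ ≤ ‖((1 - x : ℝ) : ℂ)‖ + ‖(x : ℂ) * (Complex.exp (Complex.I * (t - θ : ℝ)) - 1)‖ :=
          norm_sub_le _ _
      _ ≤ (1 - x) + 1 * (Real.pi * I.length) := by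
        rw [norm_mul, Complex.norm_real, Complex.norm_real, Real.norm_of_nonneg hx0,
          Real.norm_of_nonneg (by linarith)]
        gcongr
      -- Since `r ≥ 1 - I.length`, `1 - x` is at most `3 / 2 * I.length`, and `3 / 2 + π < 5`.
      _ ≤ 5 * I.length := by nlinarith [Real.pi_lt_d2]

/-- The `i`-th of the `n` arcs obtained by cutting `I` into arcs of equal length. -/
noncomputable def subarc (I : CircleArc) (n : ℕ) (hn : 0 < n) (i : ℕ) : CircleArc where
  left := I.left + i * ((I.right - I.left) / n)
  right := I.left + (i + 1) * ((I.right - I.left) / n)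
  left_lt_right := by
    have : 0 < (I.right - I.left) / n := div_pos (sub_pos.2 I.left_lt_right) (by positivity)
    nlinarith
  right_le := by
    have : (I.right - I.left) / n ≤ I.right - I.left :=
      div_le_self (sub_pos.2 I.left_lt_right).le (by exact_mod_cast hn)
    linarith [I.right_le]

theorem length_subarc (I : CircleArc) (n : ℕ) (hn : 0 < n) (i : ℕ) :
    (I.subarc n hn i).length = I.length / n := by
  have : (n : ℝ) ≠ 0 := by positivity
  rw [length, length, subarc]
  field_simp
  ring

theorem carlesonSquare_inter_subset_iUnion_subarc (I : CircleArc) (n : ℕ) (hn : 0 < n) :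
    I.carlesonSquare ∩ {z | 1 - ‖(z : ℂ)‖ ≤ I.length / n} ⊆
      ⋃ i ∈ Finset.range n, (I.subarc n hn i).carlesonSquare := by
  rintro z ⟨hz, hzn⟩
  obtain ⟨-, t, ht, hz⟩ := (I.mem_carlesonSquare_iff z).1 hz
  have hn' : (0 : ℝ) < n := by positivity
  set h := (I.right - I.left) / n with hh
  have hh0 : 0 < h := div_pos (sub_pos.2 I.left_lt_right) hn'
  have hnh : n * h = I.right - I.left := by rw [hh]; field_simp
  have hi : ∃ i < n, (i : ℝ) * h ≤ t - I.left ∧ t - I.left ≤ (i + 1) * h := by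
    have hx0 : 0 ≤ (t - I.left) / h := div_nonneg (by linarith [ht.1]) hh0.le
    have hxn : (t - I.left) / h ≤ n := by
      rw [div_le_iff₀ hh0, hnh]; linarith [ht.2]
    have hxh : (t - I.left) / h * h = t - I.left := by field_simp
    set x := (t - I.left) / h
    -- The index is `⌈x⌉₊ - 1`, which keeps the right endpoint `x = n` in the last subarc; the left
    -- endpoint `x = 0` needs index `0` separately.
    rcases Nat.eq_zero_or_pos ⌈x⌉₊ with h0 | h0
    · refine ⟨0, hn, ?_, ?_⟩
      · rw [Nat.cast_zero, zero_mul]; linarith [ht.1]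
      · have : x ≤ 0 := by simpa using Nat.ceil_eq_zero.1 h0
        nlinarith
    · have h1 : ⌈x⌉₊ ≤ n := Nat.ceil_le.2 hxn
      refine ⟨⌈x⌉₊ - 1, by omega, ?_, ?_⟩
      · rw [← hxh]
        have := (Nat.ceil_lt_add_one hx0).le
        rw [Nat.cast_sub h0, Nat.cast_one]
        gcongr
        linarith
      · rw [← hxh, Nat.cast_sub h0, Nat.cast_one, sub_add_cancel]
        gcongr
        exact Nat.le_ceil x
  obtain ⟨i, hin, h1, h2⟩ := hi
  refine Set.mem_biUnion (Finset.mem_coe.2 (Finset.mem_range.2 hin)) ?_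
  refine (mem_carlesonSquare_iff _ z).2 ⟨?_, t, ⟨?_, ?_⟩, hz⟩
  · rw [length_subarc]; linarith [hzn.out]
  · simp only [subarc]; linarith
  · simp only [subarc]; linarith

end CircleArc

/-! ### Carleson measures on squares and boundary layers. -/

theorem measure_carlesonSquare_le (s : ℝ) (μ : Measure unitDisc) (I : CircleArc) :
    μ I.carlesonSquare ≤ carlesonNorm s μ * ENNReal.ofReal (I.length ^ s) := by
  have hpos : 0 < I.length ^ s := Real.rpow_pos_of_pos I.length_pos s
  have := le_iSup (fun I : CircleArc => μ I.carlesonSquare / ENNReal.ofReal (I.length ^ s)) I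
  rwa [ENNReal.div_le_iff (by simpa using hpos) ENNReal.ofReal_ne_top] at this

theorem isCarlesonMeasure_of_forall_le {s : ℝ} {μ : Measure unitDisc} {C : ℝ≥0∞} (hC : C ≠ ∞)
    (h : ∀ I : CircleArc, μ I.carlesonSquare ≤ C * ENNReal.ofReal (I.length ^ s)) :
    IsCarlesonMeasure s μ := by
  refine lt_of_le_of_lt (iSup_le fun I => ?_) hC.lt_top
  have hpos : 0 < I.length ^ s := Real.rpow_pos_of_pos I.length_pos s
  rw [ENNReal.div_le_iff (by simpa using hpos) ENNReal.ofReal_ne_top]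
  exact h I

theorem measure_univ_le_carlesonNorm (s : ℝ) (μ : Measure unitDisc) :
    μ Set.univ ≤ carlesonNorm s μ := by
  have := measure_carlesonSquare_le s μ (CircleArc.centered 0 1 one_pos le_rfl)
  rwa [CircleArc.carlesonSquare_centered_zero_one, CircleArc.length_centered, Real.one_rpow,
    ENNReal.ofReal_one, mul_one] at this

/-- For `s = q + 1` the bound is `I.length ^ (q + 1) * n ^ (-q)`: the decay in `n` pays for weights
that blow up at the circle. -/
theorem measure_carlesonSquare_inter_le (s : ℝ) (μ : Measure unitDisc) (I : CircleArc) (n : ℕ)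
    (hn : 0 < n) :
    μ (I.carlesonSquare ∩ {z | 1 - ‖(z : ℂ)‖ ≤ I.length / n}) ≤
      carlesonNorm s μ * ENNReal.ofReal (n * (I.length / n) ^ s) := by
  refine (measure_mono (I.carlesonSquare_inter_subset_iUnion_subarc n hn)).trans
    ((measure_biUnion_finset_le _ _).trans ?_)
  calc ∑ i ∈ Finset.range n, μ (I.subarc n hn i).carlesonSquare
      ≤ ∑ i ∈ Finset.range n, carlesonNorm s μ * ENNReal.ofReal ((I.length / n) ^ s) := by
        refine Finset.sum_le_sum fun i _ => ?_
        rw [← I.length_subarc n hn i]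
        exact measure_carlesonSquare_le s μ _
    _ = _ := by
        rw [Finset.sum_const, Finset.card_range, nsmul_eq_mul, ENNReal.ofReal_mul (by positivity),
          ENNReal.ofReal_natCast, mul_left_comm]

/-- A Carleson measure integrates small negative powers of the distance to the circle. -/
theorem exists_lintegral_carlesonSquare_rpow_neg_le {q ε : ℝ} (hε : 0 ≤ ε) (hεq : ε < q) :
    ∃ C : ℝ, 0 < C ∧ ∀ (μ : Measure unitDisc) (I : CircleArc),
      ∫⁻ z in I.carlesonSquare, ENNReal.ofReal ((1 - ‖(z : ℂ)‖) ^ (-ε)) ∂μ ≤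
        ENNReal.ofReal C * carlesonNorm (q + 1) μ * ENNReal.ofReal (I.length ^ (q + 1 - ε)) := by
  -- Ratio of the geometric series over dyadic layers: layer `k` has mass of order `2 ^ (-q * k)`
  -- and weight of order `2 ^ (ε * k)`. Convergence is exactly `ε < q`.
  set x : ℝ := 2 ^ (ε - q) with hx
  have hx0 : 0 < x := by positivity
  have hx1 : x < 1 := Real.rpow_lt_one_of_one_lt_of_neg one_lt_two (by linarith)
  refine ⟨2 ^ ε * (1 - x)⁻¹, mul_pos (by positivity) (inv_pos.2 (by linarith)), fun μ I => ?_⟩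
  have hl := I.length_pos
  set ℓ := I.length
  set N := carlesonNorm (q + 1) μ
  set A : ℕ → Set unitDisc := fun k => {z | 1 - ‖(z : ℂ)‖ ≤ ℓ / (2 ^ k : ℕ)} with hA
  have hAm : ∀ k, MeasurableSet (A k) := fun k =>
    (isClosed_le (by fun_prop) (by fun_prop)).measurableSet
  set c : ℕ → ℝ := fun k => (ℓ / 2 ^ (k + 1)) ^ (-ε) with hc
  have hpt : ∀ z ∈ I.carlesonSquare, ENNReal.ofReal ((1 - ‖(z : ℂ)‖) ^ (-ε)) ≤
      ∑' k, (A k).indicator (fun _ => ENNReal.ofReal (c k)) z := by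
    intro z hz
    have hz1 : ‖(z : ℂ)‖ < 1 := mem_ball_zero_iff.1 z.2
    have hy0 : 0 < 1 - ‖(z : ℂ)‖ := by linarith
    have hyl : 1 - ‖(z : ℂ)‖ ≤ ℓ := by linarith [((I.mem_carlesonSquare_iff z).1 hz).1]
    -- This `k` satisfies `ℓ / 2 ^ (k + 1) < 1 - ‖z‖ ≤ ℓ / 2 ^ k`. The sets `A k` are nested, not
    -- disjoint, but one term of the sum suffices.
    obtain ⟨k, hk1, hk2⟩ := exists_nat_pow_near (x := ℓ / (1 - ‖(z : ℂ)‖)) (y := 2)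
      ((one_le_div hy0).2 hyl) one_lt_two
    have hzA : z ∈ A k := by
      rw [le_div_iff₀ hy0] at hk1
      show 1 - ‖(z : ℂ)‖ ≤ ℓ / (2 ^ k : ℕ)
      rw [le_div_iff₀ (by positivity)]
      push_cast
      linarith
    refine le_trans ?_ (ENNReal.le_tsum k)
    rw [Set.indicator_of_mem hzA]
    refine ENNReal.ofReal_le_ofReal
      (Real.rpow_le_rpow_of_nonpos (by positivity) ?_ (by linarith))
    rw [div_lt_iff₀ hy0] at hk2
    rw [div_le_iff₀ (by positivity)]
    linarith
  have hterm : ∀ k, ∫⁻ z in I.carlesonSquare, (A k).indicator (fun _ => ENNReal.ofReal (c k)) z ∂μ ≤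
      N * ENNReal.ofReal (2 ^ ε * ℓ ^ (q + 1 - ε) * x ^ k) := by
    intro k
    rw [lintegral_indicator_const (hAm k), Measure.restrict_apply (hAm k), Set.inter_comm]
    refine (mul_le_mul_right (measure_carlesonSquare_inter_le (q + 1) μ I (2 ^ k)
      (by positivity)) _).trans (le_of_eq ?_)
    rw [mul_left_comm, ← ENNReal.ofReal_mul (by positivity)]
    congr 2
    have h2k : (0 : ℝ) < 2 ^ k := by positivity
    rw [hc, hx, ← Real.rpow_natCast, ← Real.rpow_mul zero_le_two]
    push_cast
    rw [Real.div_rpow hl.le (by positivity), Real.div_rpow hl.le (by positivity),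
      ← Real.rpow_natCast, ← Real.rpow_natCast, ← Real.rpow_mul zero_le_two,
      ← Real.rpow_mul zero_le_two, sub_eq_add_neg (q + 1), Real.rpow_add hl (q + 1)]
    have e : (2 : ℝ) ^ ε * 2 ^ ((ε - q) * k) * (2 ^ (((k + 1 : ℕ) : ℝ) * -ε)) *
        2 ^ ((k : ℝ) * (q + 1)) = 2 ^ (k : ℝ) := by
      rw [← Real.rpow_add two_pos, ← Real.rpow_add two_pos, ← Real.rpow_add two_pos]
      push_cast
      ring_nf
    rw [← e]
    field_simp
  calc ∫⁻ z in I.carlesonSquare, ENNReal.ofReal ((1 - ‖(z : ℂ)‖) ^ (-ε)) ∂μ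
      ≤ ∫⁻ z in I.carlesonSquare, ∑' k, (A k).indicator (fun _ => ENNReal.ofReal (c k)) z ∂μ :=
        setLIntegral_mono' I.measurableSet_carlesonSquare hpt
    _ = ∑' k, ∫⁻ z in I.carlesonSquare, (A k).indicator (fun _ => ENNReal.ofReal (c k)) z ∂μ :=
        lintegral_tsum fun k => (measurable_const.indicator (hAm k)).aemeasurable
    _ ≤ ∑' k, N * ENNReal.ofReal (2 ^ ε * ℓ ^ (q + 1 - ε) * x ^ k) := ENNReal.tsum_le_tsum hterm
    _ = N * ENNReal.ofReal (2 ^ ε * ℓ ^ (q + 1 - ε) * (1 - x)⁻¹) := by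
        rw [ENNReal.tsum_mul_left, ← ENNReal.ofReal_tsum_of_nonneg (fun k => by positivity)
          ((summable_geometric_of_lt_one hx0.le hx1).mul_left _), tsum_mul_left,
          tsum_geometric_of_lt_one hx0.le hx1]
    _ = _ := by
        have := inv_pos.2 (sub_pos.2 hx1)
        rw [mul_right_comm (ENNReal.ofReal _), ← ENNReal.ofReal_mul (by positivity), mul_comm N]
        ring_nf

/-! ### Sufficiency of the Carleson condition. -/

instance : IsFiniteMeasure discArea := by
  have : IsFiniteMeasure ((volume : Measure ℂ).restrict unitDisc) :=
    ⟨by rw [Measure.restrict_apply_univ]; exact measure_ball_lt_top⟩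
  exact Measure.smul_finite _ ENNReal.ofReal_ne_top

theorem ae_discArea_mem_unitDisc : ∀ᵐ w ∂discArea, w ∈ unitDisc :=
  Measure.ae_smul_measure (ae_restrict_mem measurableSet_ball) _

theorem DifferentiableOn.aemeasurable_discArea {f : ℂ → ℂ} (hf : DifferentiableOn ℂ f unitDisc) :
    AEMeasurable f discArea :=
  (hf.continuousOn.aemeasurable measurableSet_ball).smul_measure _

theorem measurableSet_setOf_mem_shadowRegion (w : ℂ) :
    MeasurableSet {z : unitDisc | w ∈ shadowRegion z} :=
  (isClosed_le (f := fun z : unitDisc => dist w z) (g := fun _ => 3 * (1 - ‖w‖)) (by fun_prop)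
    (by fun_prop)).measurableSet

/-- Tonelli's theorem for the incidence set of pairs `(z, w)` with `w ∈ shadowRegion z`, which is
closed, hence measurable. -/
theorem lintegral_mul_lintegral_shadowRegion {ν : Measure unitDisc} [SFinite ν]
    {h : unitDisc → ℝ≥0∞} (hh : Measurable h) {G : ℂ → ℝ≥0∞} (hG : AEMeasurable G discArea) :
    ∫⁻ z, h z * ∫⁻ w in shadowRegion z, G w ∂discArea ∂ν =
      ∫⁻ w, G w * ∫⁻ z in {z : unitDisc | w ∈ shadowRegion z}, h z ∂ν ∂discArea := by
  set T : Set (unitDisc × ℂ) := {x | x.2 ∈ shadowRegion x.1} with hT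
  have hTm : MeasurableSet T := by
    have : IsClosed T := isClosed_le (f := fun x : unitDisc × ℂ => dist x.2 x.1)
      (g := fun x : unitDisc × ℂ => 3 * (1 - ‖x.2‖)) (by fun_prop) (by fun_prop)
    exact this.measurableSet
  have hF : AEMeasurable (T.indicator fun x => h x.1 * G x.2) (ν.prod discArea) :=
    ((hh.comp measurable_fst).aemeasurable.mul hG.comp_snd).indicator hTm
  calc ∫⁻ z, h z * ∫⁻ w in shadowRegion z, G w ∂discArea ∂ν
      = ∫⁻ z, ∫⁻ w, T.indicator (fun x => h x.1 * G x.2) (z, w) ∂discArea ∂ν := by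
        refine lintegral_congr fun z => ?_
        rw [← lintegral_const_mul'' _ hG.restrict,
          ← lintegral_indicator (measurableSet_shadowRegion _)]
        rfl
    _ = ∫⁻ w, ∫⁻ z, T.indicator (fun x => h x.1 * G x.2) (z, w) ∂ν ∂discArea :=
        lintegral_lintegral_swap hF
    _ = _ := by
        refine lintegral_congr fun w => ?_
        rw [← lintegral_const_mul _ hh,
          ← lintegral_indicator (measurableSet_setOf_mem_shadowRegion w)]
        refine lintegral_congr fun z => ?_
        simp only [Set.indicator, mul_comm (h z)]
        rfl

theorem IsCarlesonMeasure.isFiniteMeasure {s : ℝ} {μ : Measure unitDisc}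
    (h : IsCarlesonMeasure s μ) : IsFiniteMeasure μ :=
  ⟨(measure_univ_le_carlesonNorm s μ).trans_lt h⟩

theorem one_sub_norm_rpow_le (s : ℝ) {w : ℂ} (hw : w ∈ unitDisc) :
    (1 - ‖w‖) ^ s ≤ 2 ^ |s| * (1 - ‖w‖ ^ 2) ^ s := by
  have hw : ‖w‖ < 1 := mem_ball_zero_iff.1 hw
  exact Real.rpow_le_rpow_abs_mul_rpow s (by linarith) (by nlinarith [norm_nonneg w]) two_pos
    (by nlinarith [norm_nonneg w]) (by nlinarith [norm_nonneg w])

/-- The core of the tent space embedding: the constant depends neither on `I` nor on `μ`, so the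
supremum over arcs can be taken afterwards. -/
theorem exists_lintegral_carlesonSquare_enorm_rpow_le {p q : ℝ} (hp : 0 < p) (hq : 0 < q) :
    ∃ C : ℝ, 0 < C ∧ ∀ μ : Measure unitDisc, IsCarlesonMeasure (q + 1) μ →
      ∀ f : ℂ → ℂ, DifferentiableOn ℂ f unitDisc → ∀ I : CircleArc,
      ∫⁻ z in I.carlesonSquare, ‖f z‖ₑ ^ p ∂μ ≤
        ENNReal.ofReal C * carlesonNorm (q + 1) μ * (‖f 0‖ₑ ^ p +
          ∫⁻ z, ‖deriv f z‖ₑ ^ p * ENNReal.ofReal ((1 - ‖z‖ ^ 2) ^ (p - 1)) ∂discArea) *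
        ENNReal.ofReal (I.length ^ q) := by
  -- `ε < q` makes the layer sum converge; `ε < 1` makes `x ^ (1 - ε)` increasing, so lengths can be
  -- replaced by `8 * (1 - ‖w‖)`.
  set ε := min q 1 / 2 with hεdef
  have hε : 0 < ε := by positivity
  have hεq : ε < q := by linarith [min_le_left q 1]
  have hε1 : ε < 1 := by linarith [min_le_right q 1]
  obtain ⟨C₁, hC₁, hgrowth⟩ := exists_enorm_rpow_le_add_lintegral_shadowRegion hp hε
  obtain ⟨C₂, hC₂, hlayer⟩ := exists_lintegral_carlesonSquare_rpow_neg_le hε.le hεq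
  set K := C₂ * 8 ^ (1 - ε) * 2 ^ |p - 1| with hK
  have hK0 : 0 < K := by positivity
  refine ⟨C₁ * max 1 K, by positivity, fun μ hμ f hf I => ?_⟩
  have := hμ.isFiniteMeasure
  set N := carlesonNorm (q + 1) μ
  have hl := I.length_pos
  set ℓ := I.length
  set X := ∫⁻ z, ‖deriv f z‖ₑ ^ p * ENNReal.ofReal ((1 - ‖z‖ ^ 2) ^ (p - 1)) ∂discArea
  have hf' := hf.deriv Metric.isOpen_ball
  have hG : AEMeasurable
      (fun w => ‖deriv f w‖ₑ ^ p * ENNReal.ofReal ((1 - ‖w‖) ^ (p - 2 + ε))) discArea :=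
    (hf'.aemeasurable_discArea.enorm.pow_const p).mul (by fun_prop)
  have hh : Measurable fun z : unitDisc => ENNReal.ofReal ((1 - ‖(z : ℂ)‖) ^ (-ε)) := by fun_prop
  have hH : ∀ w ∈ unitDisc, ∫⁻ z in {z : unitDisc | w ∈ shadowRegion z},
      ENNReal.ofReal ((1 - ‖(z : ℂ)‖) ^ (-ε)) ∂(μ.restrict I.carlesonSquare) ≤
      ENNReal.ofReal C₂ * N * ENNReal.ofReal (ℓ ^ q * (8 * (1 - ‖w‖)) ^ (1 - ε)) := by
    intro w hw
    have hw1 : ‖w‖ < 1 := mem_ball_zero_iff.1 hw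
    obtain ⟨J, hJ, hJs⟩ := CircleArc.exists_shadow_subset_carlesonSquare hw1
    have hJ0 := J.length_pos
    have hsplit : ∀ x : ℝ, 0 < x → x ^ (q + 1 - ε) = x ^ q * x ^ (1 - ε) := fun x hx => by
      rw [← Real.rpow_add hx]; ring_nf
    -- The smaller of the two squares is used. Of the exponent `q + 1 - ε`, the part `q` is charged
    -- to `ℓ` and the part `1 - ε` to `8 * (1 - ‖w‖)`.
    rcases le_total ℓ J.length with h | h
    · refine (setLIntegral_le_lintegral _ _).trans ((hlayer μ I).trans ?_)
      change _ * ENNReal.ofReal (ℓ ^ (q + 1 - ε)) ≤ _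
      gcongr
      rw [hsplit ℓ hl]
      gcongr
      linarith
    · rw [Measure.restrict_restrict (measurableSet_setOf_mem_shadowRegion w)]
      refine (lintegral_mono_set fun z hz => hJs z hz.1).trans ((hlayer μ J).trans ?_)
      change ENNReal.ofReal C₂ * N * _ ≤ _
      gcongr
      rw [hsplit _ hJ0]
      gcongr
  have hmain : ∫⁻ z in I.carlesonSquare, ENNReal.ofReal ((1 - ‖(z : ℂ)‖) ^ (-ε)) *
      (∫⁻ w in shadowRegion z,
        ‖deriv f w‖ₑ ^ p * ENNReal.ofReal ((1 - ‖w‖) ^ (p - 2 + ε)) ∂discArea) ∂μ ≤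
      ENNReal.ofReal K * N * X * ENNReal.ofReal (ℓ ^ q) := by
    rw [lintegral_mul_lintegral_shadowRegion hh hG]
    calc _ ≤ ∫⁻ w, (ENNReal.ofReal K * N * ENNReal.ofReal (ℓ ^ q)) *
          (‖deriv f w‖ₑ ^ p * ENNReal.ofReal ((1 - ‖w‖ ^ 2) ^ (p - 1))) ∂discArea := by
          refine lintegral_mono_ae (ae_discArea_mem_unitDisc.mono fun w hw => ?_)
          have hw1 : 0 < 1 - ‖w‖ := by linarith [mem_ball_zero_iff.1 hw]
          have hw2 : 0 < 1 - ‖w‖ ^ 2 := by nlinarith [norm_nonneg w]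
          refine (mul_le_mul_right (hH w hw) _).trans ?_
          have e : ENNReal.ofReal ((1 - ‖w‖) ^ (p - 2 + ε)) * (ENNReal.ofReal C₂ *
              ENNReal.ofReal (ℓ ^ q * (8 * (1 - ‖w‖)) ^ (1 - ε))) ≤
              ENNReal.ofReal K * ENNReal.ofReal (ℓ ^ q) *
              ENNReal.ofReal ((1 - ‖w‖ ^ 2) ^ (p - 1)) := by
            rw [← ENNReal.ofReal_mul (by positivity), ← ENNReal.ofReal_mul (by positivity),
              ← ENNReal.ofReal_mul (by positivity), ← ENNReal.ofReal_mul (by positivity)]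
            refine ENNReal.ofReal_le_ofReal ?_
            have e1 : (1 - ‖w‖) ^ (p - 2 + ε) * (1 - ‖w‖) ^ (1 - ε) = (1 - ‖w‖) ^ (p - 1) := by
              rw [← Real.rpow_add hw1]; ring_nf
            rw [Real.mul_rpow (by norm_num) hw1.le]
            calc _ = C₂ * 8 ^ (1 - ε) * ℓ ^ q * (1 - ‖w‖) ^ (p - 1) := by rw [← e1]; ring
              _ ≤ C₂ * 8 ^ (1 - ε) * ℓ ^ q * (2 ^ |p - 1| * (1 - ‖w‖ ^ 2) ^ (p - 1)) := by
                gcongr; exact one_sub_norm_rpow_le _ hw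
              _ = _ := by rw [hK]; ring
          calc _ = ‖deriv f w‖ₑ ^ p * N * (ENNReal.ofReal ((1 - ‖w‖) ^ (p - 2 + ε)) *
                (ENNReal.ofReal C₂ *
                ENNReal.ofReal (ℓ ^ q * (8 * (1 - ‖w‖)) ^ (1 - ε)))) := by ring
            _ ≤ ‖deriv f w‖ₑ ^ p * N * _ := mul_le_mul_right e _
            _ = _ := by ring
      _ = _ := by
          refine (lintegral_const_mul'' _ ((hf'.aemeasurable_discArea.enorm.pow_const p).mul
            (by fun_prop))).trans ?_
          change _ * X = _
          ring
  have hsq : μ I.carlesonSquare ≤ N * ENNReal.ofReal (ℓ ^ q) := by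
    refine (measure_carlesonSquare_le (q + 1) μ I).trans (mul_le_mul_right
      (ENNReal.ofReal_le_ofReal ?_) _)
    exact Real.rpow_le_rpow_of_exponent_ge hl I.length_le_one (by linarith)
  calc ∫⁻ z in I.carlesonSquare, ‖f z‖ₑ ^ p ∂μ
      ≤ ∫⁻ z in I.carlesonSquare, (ENNReal.ofReal C₁ * ‖f 0‖ₑ ^ p + ENNReal.ofReal C₁ *
        (ENNReal.ofReal ((1 - ‖(z : ℂ)‖) ^ (-ε)) * ∫⁻ w in shadowRegion z,
          ‖deriv f w‖ₑ ^ p * ENNReal.ofReal ((1 - ‖w‖) ^ (p - 2 + ε)) ∂discArea)) ∂μ :=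
        lintegral_mono fun z => hgrowth f hf z z.2
    _ = ENNReal.ofReal C₁ * (‖f 0‖ₑ ^ p * μ I.carlesonSquare) + ENNReal.ofReal C₁ *
        ∫⁻ z in I.carlesonSquare, (ENNReal.ofReal ((1 - ‖(z : ℂ)‖) ^ (-ε)) *
        ∫⁻ w in shadowRegion z,
          ‖deriv f w‖ₑ ^ p * ENNReal.ofReal ((1 - ‖w‖) ^ (p - 2 + ε)) ∂discArea) ∂μ := by
        rw [lintegral_add_left measurable_const, setLIntegral_const,
          lintegral_const_mul' _ _ ENNReal.ofReal_ne_top, mul_assoc]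
    _ ≤ ENNReal.ofReal C₁ * (‖f 0‖ₑ ^ p * (N * ENNReal.ofReal (ℓ ^ q))) + ENNReal.ofReal C₁ *
        (ENNReal.ofReal K * N * X * ENNReal.ofReal (ℓ ^ q)) := by gcongr
    _ ≤ ENNReal.ofReal C₁ * (ENNReal.ofReal (max 1 K) *
        (‖f 0‖ₑ ^ p * (N * ENNReal.ofReal (ℓ ^ q)))) + ENNReal.ofReal C₁ *
        (ENNReal.ofReal (max 1 K) * N * X * ENNReal.ofReal (ℓ ^ q)) := by
        have h1 : 1 ≤ ENNReal.ofReal (max 1 K) := ENNReal.one_le_ofReal.2 (le_max_left _ _)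
        have h2 : ENNReal.ofReal K ≤ ENNReal.ofReal (max 1 K) :=
          ENNReal.ofReal_le_ofReal (le_max_right _ _)
        exact add_le_add (mul_le_mul_right (le_mul_of_one_le_left zero_le h1) _) (by gcongr)
    _ = _ := by
        rw [ENNReal.ofReal_mul hC₁.le]
        ring

/-- With no derivative to integrate, the sub-mean value property with weight exponent `-2` suffices:
the points whose region contains `w` have measure of order `(1 - ‖w‖) ^ (q + 1)`, which leaves the
weight exponent `q - 1`. The divisor `q` in `K` cancels the normalization of the Bergman norm. -/
theorem exists_lintegral_enorm_rpow_le {p q : ℝ} (hp : 0 < p) (hq : 0 < q) :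
    ∃ C : ℝ, 0 < C ∧ ∀ μ : Measure unitDisc, IsCarlesonMeasure (q + 1) μ →
      ∀ f : ℂ → ℂ, DifferentiableOn ℂ f unitDisc →
      ∫⁻ z, ‖f z‖ₑ ^ p ∂μ ≤ ENNReal.ofReal C * carlesonNorm (q + 1) μ *
        ∫⁻ z, ‖f z‖ₑ ^ p * ENNReal.ofReal ((q - 1 + 1) * (1 - ‖z‖ ^ 2) ^ (q - 1)) ∂discArea := by
  obtain ⟨C₁, hC₁, hlocal⟩ := exists_enorm_rpow_le_lintegral_discArea hp (-2)
  set K := 8 ^ (q + 1) * 2 ^ |q - 1| / q with hK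
  have hK0 : 0 < K := by positivity
  refine ⟨C₁ * K, by positivity, fun μ hμ f hf => ?_⟩
  have := hμ.isFiniteMeasure
  set N := carlesonNorm (q + 1) μ
  have hG : AEMeasurable
      (fun w => ‖f w‖ₑ ^ p * ENNReal.ofReal ((1 - ‖w‖) ^ (-2 : ℝ))) discArea :=
    (hf.aemeasurable_discArea.enorm.pow_const p).mul (by fun_prop)
  have hpt : ∀ z : unitDisc, ‖f z‖ₑ ^ p ≤ ENNReal.ofReal C₁ * ∫⁻ w in shadowRegion z,
      ‖f w‖ₑ ^ p * ENNReal.ofReal ((1 - ‖w‖) ^ (-2 : ℝ)) ∂discArea := by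
    intro z
    refine (hlocal f hf z z.2).trans ?_
    rw [sub_self, Real.rpow_zero, mul_one]
    gcongr
    have := ball_subset_shadowRegion (z := z) (Set.right_mem_Icc.2 zero_le_one)
      (mem_ball_zero_iff.1 z.2)
    simpa using this
  calc ∫⁻ z, ‖f z‖ₑ ^ p ∂μ
      ≤ ∫⁻ z, ENNReal.ofReal C₁ * ∫⁻ w in shadowRegion z,
        ‖f w‖ₑ ^ p * ENNReal.ofReal ((1 - ‖w‖) ^ (-2 : ℝ)) ∂discArea ∂μ :=
        lintegral_mono fun z => hpt z
    _ = ∫⁻ w, (‖f w‖ₑ ^ p * ENNReal.ofReal ((1 - ‖w‖) ^ (-2 : ℝ))) *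
        ∫⁻ z in {z : unitDisc | w ∈ shadowRegion z}, ENNReal.ofReal C₁ ∂μ ∂discArea :=
        lintegral_mul_lintegral_shadowRegion measurable_const hG
    _ ≤ ∫⁻ w, (ENNReal.ofReal (C₁ * K) * N) *
        (‖f w‖ₑ ^ p * ENNReal.ofReal ((q - 1 + 1) * (1 - ‖w‖ ^ 2) ^ (q - 1))) ∂discArea := by
        refine lintegral_mono_ae (ae_discArea_mem_unitDisc.mono fun w hw => ?_)
        have hw0 : ‖w‖ < 1 := mem_ball_zero_iff.1 hw
        have hw1 : 0 < 1 - ‖w‖ := by linarith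
        have hw2 : 0 < 1 - ‖w‖ ^ 2 := by nlinarith [norm_nonneg w]
        obtain ⟨J, hJ, hJs⟩ := CircleArc.exists_shadow_subset_carlesonSquare hw0
        have hJ0 := J.length_pos
        have hm : μ {z : unitDisc | w ∈ shadowRegion z} ≤
            N * ENNReal.ofReal ((8 * (1 - ‖w‖)) ^ (q + 1)) := by
          refine (measure_mono fun z hz => hJs z hz).trans
            ((measure_carlesonSquare_le (q + 1) μ J).trans ?_)
          change N * _ ≤ _
          gcongr
        rw [setLIntegral_const]
        have e : ENNReal.ofReal ((1 - ‖w‖) ^ (-2 : ℝ)) * ENNReal.ofReal C₁ *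
            ENNReal.ofReal ((8 * (1 - ‖w‖)) ^ (q + 1)) ≤ ENNReal.ofReal (C₁ * K) *
            ENNReal.ofReal ((q - 1 + 1) * (1 - ‖w‖ ^ 2) ^ (q - 1)) := by
          rw [← ENNReal.ofReal_mul (by positivity), ← ENNReal.ofReal_mul (by positivity),
            ← ENNReal.ofReal_mul (by positivity)]
          refine ENNReal.ofReal_le_ofReal ?_
          have e1 : (1 - ‖w‖) ^ (-2 : ℝ) * (1 - ‖w‖) ^ (q + 1) = (1 - ‖w‖) ^ (q - 1) := by
            rw [← Real.rpow_add hw1]; ring_nf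
          rw [Real.mul_rpow (by norm_num) hw1.le]
          calc _ = C₁ * 8 ^ (q + 1) * (1 - ‖w‖) ^ (q - 1) := by rw [← e1]; ring
            _ ≤ C₁ * 8 ^ (q + 1) * (2 ^ |q - 1| * (1 - ‖w‖ ^ 2) ^ (q - 1)) := by
              gcongr; exact one_sub_norm_rpow_le _ hw
            _ = _ := by rw [hK, sub_add_cancel]; field_simp
        calc _ ≤ ‖f w‖ₑ ^ p * ENNReal.ofReal ((1 - ‖w‖) ^ (-2 : ℝ)) * (ENNReal.ofReal C₁ *
              (N * ENNReal.ofReal ((8 * (1 - ‖w‖)) ^ (q + 1)))) := by gcongr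
          _ = ‖f w‖ₑ ^ p * N * (ENNReal.ofReal ((1 - ‖w‖) ^ (-2 : ℝ)) * ENNReal.ofReal C₁ *
              ENNReal.ofReal ((8 * (1 - ‖w‖)) ^ (q + 1))) := by ring
          _ ≤ ‖f w‖ₑ ^ p * N * _ := mul_le_mul_right e _
          _ = _ := by ring
    _ = _ := lintegral_const_mul'' _ ((hf.aemeasurable_discArea.enorm.pow_const p).mul
          (by fun_prop))

/-! ### Forelli-Rudin estimates. -/

/-- Split at `x = δ`: below, `δ + x` is replaced by `δ` and `c > -1` gives integrability at `0`;
above, it is replaced by `x` and `t > c + 1` gives integrability at infinity. -/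
theorem exists_lintegral_Ioi_rpow_mul_add_rpow_neg_le {c t : ℝ} (hc : -1 < c) (ht : c + 1 < t) :
    ∃ C : ℝ, 0 < C ∧ ∀ δ : ℝ, 0 < δ →
      ∫⁻ x in Set.Ioi (0 : ℝ), ENNReal.ofReal (x ^ c * (δ + x) ^ (-t)) ≤
        ENNReal.ofReal (C * δ ^ (c + 1 - t)) := by
  have hc1 : 0 < c + 1 := by linarith
  have htc : 0 < t - c - 1 := by linarith
  refine ⟨1 / (c + 1) + 1 / (t - c - 1), by positivity, fun δ hδ => ?_⟩
  have h1 : ∫⁻ x in Set.Ioc 0 δ, ENNReal.ofReal (x ^ c * (δ + x) ^ (-t)) ≤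
      ENNReal.ofReal (1 / (c + 1) * δ ^ (c + 1 - t)) := by
    have hint : IntegrableOn (fun x : ℝ => x ^ c) (Set.Ioc 0 δ) :=
      (intervalIntegrable_iff_integrableOn_Ioc_of_le hδ.le).1
        (intervalIntegral.intervalIntegrable_rpow' hc)
    calc _ ≤ ∫⁻ x in Set.Ioc 0 δ, ENNReal.ofReal (δ ^ (-t) * x ^ c) := by
          refine setLIntegral_mono' measurableSet_Ioc fun x hx => ENNReal.ofReal_le_ofReal ?_
          rw [mul_comm]
          have := Real.rpow_nonneg hx.1.le c
          gcongr ?_ * _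
          exact Real.rpow_le_rpow_of_nonpos hδ (by linarith [hx.1]) (by linarith)
      _ = ENNReal.ofReal (∫ x in Set.Ioc 0 δ, δ ^ (-t) * x ^ c) := by
          refine (ofReal_integral_eq_lintegral_ofReal (hint.const_mul _) ?_).symm
          filter_upwards [ae_restrict_mem measurableSet_Ioc] with x hx
          exact mul_nonneg (by positivity) (Real.rpow_nonneg hx.1.le c)
      _ = _ := by
          rw [integral_const_mul, ← intervalIntegral.integral_of_le hδ.le,
            integral_rpow (Or.inl hc), Real.zero_rpow hc1.ne', sub_zero, sub_eq_add_neg (c + 1),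
            Real.rpow_add hδ (c + 1) (-t)]
          ring_nf
  have h2 : ∫⁻ x in Set.Ioi δ, ENNReal.ofReal (x ^ c * (δ + x) ^ (-t)) ≤
      ENNReal.ofReal (1 / (t - c - 1) * δ ^ (c + 1 - t)) := by
    have hlt : c - t < -1 := by linarith
    calc _ ≤ ∫⁻ x in Set.Ioi δ, ENNReal.ofReal (x ^ (c - t)) := by
          refine setLIntegral_mono' measurableSet_Ioi fun x hx => ENNReal.ofReal_le_ofReal ?_
          have hx0 : 0 < x := hδ.trans hx
          rw [sub_eq_add_neg, Real.rpow_add hx0]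
          exact mul_le_mul_of_nonneg_left
            (Real.rpow_le_rpow_of_nonpos hx0 (by linarith) (by linarith)) (by positivity)
      _ = ENNReal.ofReal (∫ x in Set.Ioi δ, x ^ (c - t)) := by
          refine (ofReal_integral_eq_lintegral_ofReal (integrableOn_Ioi_rpow_of_lt hlt hδ) ?_).symm
          filter_upwards [ae_restrict_mem measurableSet_Ioi] with x hx
          exact Real.rpow_nonneg (hδ.trans hx).le _
      _ = _ := by
          rw [integral_Ioi_rpow_of_lt hlt hδ]
          congr 1
          have e : c - t + 1 = -(t - c - 1) := by ring
          have e2 : c + 1 - t = -(t - c - 1) := by ring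
          rw [e, e2]
          field_simp
  rw [← Set.Ioc_union_Ioi_eq_Ioi hδ.le]
  refine (lintegral_union_le _ _ _).trans ((add_le_add h1 h2).trans (le_of_eq ?_))
  rw [← ENNReal.ofReal_add (by positivity) (by positivity), add_mul]

theorem exists_lintegral_add_abs_rpow_neg_le {t : ℝ} (ht : 1 < t) :
    ∃ C : ℝ, 0 < C ∧ ∀ δ : ℝ, 0 < δ →
      ∫⁻ x : ℝ, ENNReal.ofReal ((δ + |x|) ^ (-t)) ≤ ENNReal.ofReal (C * δ ^ (1 - t)) := by
  obtain ⟨C, hC, h⟩ := exists_lintegral_Ioi_rpow_mul_add_rpow_neg_le (c := 0) (t := t)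
    (by norm_num) (by linarith)
  refine ⟨2 * C, by positivity, fun δ hδ => ?_⟩
  set F : ℝ → ℝ≥0∞ := (Set.Ioi (0 : ℝ)).indicator
    fun x => ENNReal.ofReal (x ^ (0 : ℝ) * (δ + x) ^ (-t)) with hF
  have hFi : ∫⁻ x, F x ≤ ENNReal.ofReal (C * δ ^ (1 - t)) := by
    rw [hF, lintegral_indicator measurableSet_Ioi]
    simpa using h δ hδ
  have hFm : Measurable F := (by fun_prop : Measurable _).indicator measurableSet_Ioi
  calc ∫⁻ x : ℝ, ENNReal.ofReal ((δ + |x|) ^ (-t)) ≤ ∫⁻ x, (F x + F (-x)) := by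
        refine lintegral_mono_ae ?_
        filter_upwards [Measure.ae_ne volume (0 : ℝ)] with x hx
        rcases hx.lt_or_gt with h0 | h0
        · have : F (-x) = ENNReal.ofReal ((δ + |x|) ^ (-t)) := by
            rw [hF, Set.indicator_of_mem (Set.mem_Ioi.2 (neg_pos.2 h0)), abs_of_neg h0,
              Real.rpow_zero, one_mul]
          rw [this]; exact le_add_self
        · have : F x = ENNReal.ofReal ((δ + |x|) ^ (-t)) := by
            rw [hF, Set.indicator_of_mem (Set.mem_Ioi.2 h0), abs_of_pos h0,
              Real.rpow_zero, one_mul]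
          rw [this]; exact le_self_add
    _ = (∫⁻ x, F x) + ∫⁻ x, F x := by
        rw [lintegral_add_left hFm, lintegral_neg_eq_self]
    _ ≤ _ := by
        refine (add_le_add hFi hFi).trans (le_of_eq ?_)
        rw [← ENNReal.ofReal_add (by positivity) (by positivity)]
        ring_nf

/-- The squared modulus is `1 - 2 * x * cos θ + x ^ 2`. The second bound uses `cos θ ≤ 1 - 2 * s`
with `s = θ ^ 2 / π ^ 2 ≤ 1`, since `(1 - x) ^ 2 + 4 * x * s - s = (1 - x) ^ 2 * (1 - s) + s * (x ^
2 + 2 * x)`. -/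
theorem norm_one_sub_mul_cos_add_sin_ge {x θ : ℝ} (hx0 : 0 ≤ x) (hθ : |θ| ≤ Real.pi) :
    1 - x ≤ ‖(1 : ℂ) - x * (Real.cos θ + Real.sin θ * Complex.I)‖ ∧
      |θ| / Real.pi ≤ ‖(1 : ℂ) - x * (Real.cos θ + Real.sin θ * Complex.I)‖ := by
  have hsq : ‖(1 : ℂ) - x * (Real.cos θ + Real.sin θ * Complex.I)‖ ^ 2 =
      1 - 2 * x * Real.cos θ + x ^ 2 := by
    have e : (1 : ℂ) - x * (Real.cos θ + Real.sin θ * Complex.I) =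
        ((1 - x * Real.cos θ : ℝ) : ℂ) + ((-(x * Real.sin θ) : ℝ) : ℂ) * Complex.I := by
      push_cast; ring
    rw [e, ← Complex.normSq_eq_norm_sq, Complex.normSq_add_mul_I]
    nlinarith [Real.sin_sq_add_cos_sq θ]
  have hpi := Real.pi_pos
  constructor
  · refine le_of_sq_le_sq ?_ (norm_nonneg _)
    rw [hsq]
    nlinarith [Real.cos_le_one θ]
  · refine le_of_sq_le_sq ?_ (norm_nonneg _)
    rw [hsq, div_pow, sq_abs]
    have h1 := Real.cos_le_one_sub_mul_cos_sq hθ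
    have hs : θ ^ 2 / Real.pi ^ 2 ≤ 1 := by
      rw [div_le_one (by positivity)]
      exact sq_le_sq' (by linarith [(abs_le.1 hθ).1]) (abs_le.1 hθ).2
    have hs0 : 0 ≤ θ ^ 2 / Real.pi ^ 2 := by positivity
    rw [div_mul_eq_mul_div, mul_div_assoc] at h1
    set s := θ ^ 2 / Real.pi ^ 2
    have h2 : x * Real.cos θ ≤ x * (1 - 2 * s) := mul_le_mul_of_nonneg_left h1 hx0
    nlinarith [mul_nonneg (sq_nonneg (1 - x)) (sub_nonneg.2 hs), mul_nonneg hx0 hs0,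
      mul_nonneg (sq_nonneg x) hs0]

theorem lintegral_rotation_discArea (u : Circle) (F : ℂ → ℝ≥0∞) :
    ∫⁻ z, F (u * z) ∂discArea = ∫⁻ z, F z ∂discArea := by
  rw [discArea, lintegral_smul_measure, lintegral_smul_measure,
    ← lintegral_indicator measurableSet_ball, ← lintegral_indicator measurableSet_ball,
    ← (LinearIsometryEquiv.measurePreserving (rotation u)).lintegral_comp_emb
      (rotation u).toHomeomorph.measurableEmbedding (unitDisc.indicator F)]
  congr 1
  refine lintegral_congr fun z => ?_
  have : (u : ℂ) * z ∈ unitDisc ↔ z ∈ unitDisc := by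
    rw [mem_ball_zero_iff, mem_ball_zero_iff, norm_mul, Circle.norm_coe, one_mul]
  rw [rotation_apply]
  by_cases hz : z ∈ unitDisc
  · rw [Set.indicator_of_mem hz, Set.indicator_of_mem (this.2 hz)]
  · rw [Set.indicator_of_notMem hz, Set.indicator_of_notMem (mt this.1 hz)]

theorem one_sub_sq_rpow_le (c : ℝ) {r : ℝ} (h0 : 0 ≤ r) (h1 : r < 1) :
    (1 - r ^ 2) ^ c ≤ 2 ^ |c| * (1 - r) ^ c :=
  Real.rpow_le_rpow_abs_mul_rpow c (by nlinarith) (by linarith) two_pos (by nlinarith)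
    (by nlinarith)

/-- The Forelli-Rudin estimate for a kernel with pole on the positive axis. -/
theorem exists_lintegral_forelliRudin_ofReal_le {c t : ℝ} (hc : -1 < c) (ht : c + 2 < t) :
    ∃ C : ℝ, 0 < C ∧ ∀ a : ℝ, 0 ≤ a → a < 1 →
      ∫⁻ z, ENNReal.ofReal ((1 - ‖z‖ ^ 2) ^ c * ‖1 - (a : ℂ) * z‖ ^ (-t)) ∂discArea ≤
        ENNReal.ofReal (C * (1 - a) ^ (c + 2 - t)) := by
  -- Half of the excess exponent, so that `t = (c + 1 + η) + (1 + η)`. The kernel is then dominated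
  -- by a product of a radial and an angular factor, each integrating to order `δ ^ (-η)`.
  set η := (t - c - 2) / 2 with hη
  have hη0 : 0 < η := by rw [hη]; linarith
  obtain ⟨C₁, hC₁, hr⟩ := exists_lintegral_Ioi_rpow_mul_add_rpow_neg_le (c := c)
    (t := c + 1 + η) hc (by linarith)
  obtain ⟨C₂, hC₂, hθ⟩ := exists_lintegral_add_abs_rpow_neg_le (t := 1 + η) (by linarith)
  set A : ℝ := 2 ^ |c| * 2 ^ (c + 1 + η) * (2 * Real.pi) ^ (1 + η) with hA
  have hA0 : 0 < A := by positivity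
  have hpi := Real.pi_pos
  refine ⟨1 / Real.pi * (A * (C₁ * C₂)), by positivity, fun a ha0 ha1 => ?_⟩
  set δ := 1 - a with hδ
  have hδ0 : 0 < δ := by linarith
  set f : ℝ → ℝ≥0∞ := fun r => (Set.Ioi (0 : ℝ)).indicator
    (fun x => ENNReal.ofReal (x ^ c * (δ + x) ^ (-(c + 1 + η)))) (1 - r) with hf
  set g : ℝ → ℝ≥0∞ := fun θ => ENNReal.ofReal ((δ + |θ|) ^ (-(1 + η))) with hg
  have hfm : Measurable f := by
    have : Measurable ((Set.Ioi (0 : ℝ)).indicator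
      (fun x => ENNReal.ofReal (x ^ c * (δ + x) ^ (-(c + 1 + η))))) :=
      (by fun_prop : Measurable _).indicator measurableSet_Ioi
    exact this.comp (measurable_const.sub measurable_id)
  have hgm : Measurable g := by fun_prop
  have hfi : ∫⁻ r, f r ≤ ENNReal.ofReal (C₁ * δ ^ (-η)) := by
    rw [hf, lintegral_sub_left_eq_self, lintegral_indicator measurableSet_Ioi]
    refine (hr δ hδ0).trans (le_of_eq ?_)
    ring_nf
  have hgi : ∫⁻ θ, g θ ≤ ENNReal.ofReal (C₂ * δ ^ (-η)) := by
    refine (hθ δ hδ0).trans (le_of_eq ?_)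
    ring_nf
  have hpt : ∀ x ∈ polarCoord.target, ENNReal.ofReal x.1 • unitDisc.indicator
      (fun z => ENNReal.ofReal ((1 - ‖z‖ ^ 2) ^ c * ‖1 - (a : ℂ) * z‖ ^ (-t)))
      (Complex.polarCoord.symm x) ≤ ENNReal.ofReal A * (f x.1 * g x.2) := by
    rintro ⟨r, θ⟩ hx
    rw [polarCoord_target, Set.mem_prod, Set.mem_Ioi, Set.mem_Ioo] at hx
    obtain ⟨hr0, hθ1, hθ2⟩ := hx
    simp only at hr0 hθ1 hθ2
    have hnorm : ‖Complex.polarCoord.symm (r, θ)‖ = r := by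
      rw [Complex.norm_polarCoord_symm, abs_of_pos hr0]
    by_cases hr1 : r < 1
    · have hmem : Complex.polarCoord.symm (r, θ) ∈ unitDisc := by
        rw [mem_ball_zero_iff, hnorm]; exact hr1
      have hr1' : 0 < 1 - r := by linarith
      rw [Set.indicator_of_mem hmem, hnorm, Complex.polarCoord_symm_apply, smul_eq_mul, hf, hg]
      simp only
      rw [Set.indicator_of_mem (Set.mem_Ioi.2 hr1'), ← ENNReal.ofReal_mul (by positivity),
        ← ENNReal.ofReal_mul (by positivity), ← ENNReal.ofReal_mul (by positivity)]
      refine ENNReal.ofReal_le_ofReal ?_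
      obtain ⟨d1, d2⟩ := norm_one_sub_mul_cos_add_sin_ge (mul_nonneg ha0 hr0.le)
        (abs_le.2 ⟨hθ1.le, hθ2.le⟩)
      rw [Complex.ofReal_mul, mul_assoc] at d1 d2
      set D := ‖(1 : ℂ) - a * (r * (Real.cos θ + Real.sin θ * Complex.I))‖
      -- The distance `D` dominates `1 - a * r`, hence both `δ` and `1 - r`, hence their mean.
      have k1 : (δ + (1 - r)) / 2 ≤ D := by nlinarith
      have k2 : (δ + |θ|) / (2 * Real.pi) ≤ D := by
        rw [div_le_iff₀ (by positivity)]
        rw [div_le_iff₀ hpi] at d2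
        have : δ ≤ D := by nlinarith
        have : D ≤ D * Real.pi := by nlinarith [Real.pi_gt_three]
        linarith
      have hD : 0 < D := lt_of_lt_of_le (by positivity) k1
      have l1 : D ^ (-(c + 1 + η)) ≤ 2 ^ (c + 1 + η) * (δ + (1 - r)) ^ (-(c + 1 + η)) := by
        refine (Real.rpow_le_rpow_of_nonpos (by positivity) k1 (by linarith)).trans (le_of_eq ?_)
        rw [Real.div_rpow (by positivity) zero_le_two, Real.rpow_neg zero_le_two]
        field_simp
      have l2 : D ^ (-(1 + η)) ≤ (2 * Real.pi) ^ (1 + η) * (δ + |θ|) ^ (-(1 + η)) := by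
        refine (Real.rpow_le_rpow_of_nonpos (by positivity) k2 (by linarith)).trans (le_of_eq ?_)
        rw [Real.div_rpow (by positivity) (by positivity),
          Real.rpow_neg (x := 2 * Real.pi) (by positivity)]
        field_simp
      have hDt : D ^ (-t) = D ^ (-(c + 1 + η)) * D ^ (-(1 + η)) := by
        rw [← Real.rpow_add hD]
        congr 1
        rw [hη]; ring
      have hsq : 0 < 1 - r ^ 2 := by nlinarith
      calc r * ((1 - r ^ 2) ^ c * D ^ (-t)) ≤ 1 * ((1 - r ^ 2) ^ c * D ^ (-t)) := by gcongr
        _ = (1 - r ^ 2) ^ c * (D ^ (-(c + 1 + η)) * D ^ (-(1 + η))) := by rw [one_mul, hDt]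
        _ ≤ (2 ^ |c| * (1 - r) ^ c) * ((2 ^ (c + 1 + η) * (δ + (1 - r)) ^ (-(c + 1 + η))) *
            ((2 * Real.pi) ^ (1 + η) * (δ + |θ|) ^ (-(1 + η)))) := by
          gcongr
          exact one_sub_sq_rpow_le c hr0.le hr1
        _ = _ := by rw [hA]; ring
    · have hmem : Complex.polarCoord.symm (r, θ) ∉ unitDisc := by
        rw [mem_ball_zero_iff, hnorm]; exact hr1
      rw [Set.indicator_of_notMem hmem, smul_zero]
      exact zero_le
  rw [discArea, lintegral_smul_measure, ← lintegral_indicator measurableSet_ball,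
    ← Complex.lintegral_comp_polarCoord_symm, smul_eq_mul, mul_assoc (1 / Real.pi),
    ENNReal.ofReal_mul (by positivity)]
  gcongr
  calc _ ≤ ∫⁻ x in polarCoord.target, ENNReal.ofReal A * (f x.1 * g x.2) :=
        setLIntegral_mono' polarCoord.open_target.measurableSet hpt
    _ ≤ ∫⁻ x : ℝ × ℝ, ENNReal.ofReal A * (f x.1 * g x.2) := setLIntegral_le_lintegral _ _
    _ = ENNReal.ofReal A * ((∫⁻ r, f r) * ∫⁻ θ, g θ) := by
        rw [lintegral_const_mul' _ _ ENNReal.ofReal_ne_top, Measure.volume_eq_prod,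
          lintegral_prod_mul hfm.aemeasurable hgm.aemeasurable]
    _ ≤ ENNReal.ofReal A * (ENNReal.ofReal (C₁ * δ ^ (-η)) * ENNReal.ofReal (C₂ * δ ^ (-η))) := by
        gcongr
    _ = _ := by
        rw [← ENNReal.ofReal_mul (by positivity), ← ENNReal.ofReal_mul (by positivity)]
        congr 1
        have : c + 2 - t = -η + -η := by rw [hη]; ring
        rw [this, Real.rpow_add hδ0]
        ring

/-- The Forelli-Rudin estimate. -/
theorem exists_lintegral_forelliRudin_le {c t : ℝ} (hc : -1 < c) (ht : c + 2 < t) :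
    ∃ C : ℝ, 0 < C ∧ ∀ a : ℂ, ‖a‖ < 1 →
      ∫⁻ z, ENNReal.ofReal ((1 - ‖z‖ ^ 2) ^ c * ‖1 - (starRingEnd ℂ) a * z‖ ^ (-t)) ∂discArea ≤
        ENNReal.ofReal (C * (1 - ‖a‖) ^ (c + 2 - t)) := by
  obtain ⟨C, hC, h⟩ := exists_lintegral_forelliRudin_ofReal_le hc ht
  refine ⟨C, hC, fun a ha => ?_⟩
  -- The rotation by `arg a` carries the pole direction of the kernel to the positive axis,
  -- replacing `conj a` by `‖a‖`.
  rw [← lintegral_rotation_discArea (Circle.exp (Complex.arg a))]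
  refine le_trans (le_of_eq (lintegral_congr fun z => ?_)) (h ‖a‖ (norm_nonneg a) ha)
  rw [norm_mul, Circle.norm_coe, one_mul, ← mul_assoc, Circle.coe_exp]
  congr 5
  conv_lhs => rw [← Complex.norm_mul_exp_arg_mul_I a]
  rw [map_mul, Complex.conj_ofReal, ← Complex.exp_conj, map_mul, Complex.conj_ofReal,
    Complex.conj_I, Complex.norm_mul_exp_arg_mul_I, mul_assoc, mul_assoc, ← mul_assoc (Complex.exp _),
    ← Complex.exp_add]
  simp

/-! ### Necessity of the Carleson condition by test functions. -/

/-- The kernel functions on which the embeddings are tested. -/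
noncomputable def testFunction (a : ℂ) (n : ℕ) (z : ℂ) : ℂ := ((1 - (starRingEnd ℂ) a * z) ^ n)⁻¹

theorem one_sub_conj_mul_ne_zero {a z : ℂ} (ha : ‖a‖ < 1) (hz : z ∈ unitDisc) :
    1 - (starRingEnd ℂ) a * z ≠ 0 := by
  intro h
  have hz : ‖z‖ < 1 := mem_ball_zero_iff.1 hz
  have h1 : ‖(starRingEnd ℂ) a * z‖ = 1 := by rw [← sub_eq_zero.1 h, norm_one]
  rw [norm_mul, RCLike.norm_conj] at h1
  nlinarith [norm_nonneg a, norm_nonneg z]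

theorem hasDerivAt_testFunction {a z : ℂ} (n : ℕ) (ha : ‖a‖ < 1) (hz : z ∈ unitDisc) :
    HasDerivAt (testFunction a n) (n * (starRingEnd ℂ) a * testFunction a (n + 1) z) z := by
  have h0 := one_sub_conj_mul_ne_zero ha hz
  have h1 : HasDerivAt (fun z : ℂ => 1 - (starRingEnd ℂ) a * z) (-(starRingEnd ℂ) a) z := by
    simpa using ((hasDerivAt_id z).const_mul ((starRingEnd ℂ) a)).const_sub 1
  refine ((h1.pow n).inv (pow_ne_zero n h0)).congr_deriv ?_
  rw [testFunction]
  rcases n with _ | n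
  · simp
  · simp only [Nat.add_sub_cancel, Pi.pow_apply]
    field_simp
    ring

theorem differentiableOn_testFunction {a : ℂ} (n : ℕ) (ha : ‖a‖ < 1) :
    DifferentiableOn ℂ (testFunction a n) unitDisc := fun _ hz =>
  (hasDerivAt_testFunction n ha hz).differentiableAt.differentiableWithinAt

theorem enorm_testFunction_rpow {p : ℝ} (hp : 0 ≤ p) (a : ℂ) (n : ℕ) (z : ℂ) :
    ‖testFunction a n z‖ₑ ^ p = ENNReal.ofReal (‖1 - (starRingEnd ℂ) a * z‖ ^ (-(n * p))) := by
  rw [enorm_rpow_eq_ofReal hp, testFunction, norm_inv, norm_pow, ← Real.rpow_natCast,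
    ← Real.rpow_neg (norm_nonneg _), ← Real.rpow_mul (norm_nonneg _), neg_mul]

/-- Differentiation raises the kernel exponent to `n + 1`, so Forelli-Rudin applies with `c = p - 1`
and `t = (n + 1) * p`, giving `c + 2 - t = 1 - n * p`. -/
theorem exists_dirichletIntegral_testFunction_le {p : ℝ} {n : ℕ} (hp : 0 < p) (hn : 1 < n * p) :
    ∃ C : ℝ, 0 < C ∧ ∀ a : ℂ, ‖a‖ < 1 → ‖testFunction a n 0‖ₑ ^ p +
      ∫⁻ z, ‖deriv (testFunction a n) z‖ₑ ^ p * ENNReal.ofReal ((1 - ‖z‖ ^ 2) ^ (p - 1)) ∂discArea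
        ≤ ENNReal.ofReal (C * (1 - ‖a‖) ^ (1 - n * p)) := by
  obtain ⟨C, hC, h⟩ := exists_lintegral_forelliRudin_le (c := p - 1) (t := ((n + 1 : ℕ) : ℝ) * p)
    (by linarith) (by push_cast; linarith)
  refine ⟨1 + n ^ p * C, by positivity, fun a ha => ?_⟩
  have ha0 : 0 < 1 - ‖a‖ := by linarith
  have h1 : ‖testFunction a n 0‖ₑ ^ p ≤ ENNReal.ofReal ((1 - ‖a‖) ^ (1 - n * p)) := by
    rw [enorm_testFunction_rpow hp.le]
    refine ENNReal.ofReal_le_ofReal ?_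
    simpa using Real.one_le_rpow_of_pos_of_le_one_of_nonpos ha0 (by linarith [norm_nonneg a])
      (by linarith)
  have h2 : ∫⁻ z, ‖deriv (testFunction a n) z‖ₑ ^ p *
      ENNReal.ofReal ((1 - ‖z‖ ^ 2) ^ (p - 1)) ∂discArea ≤
      ENNReal.ofReal (n ^ p) * ENNReal.ofReal (C * (1 - ‖a‖) ^ (1 - n * p)) := by
    calc _ ≤ ∫⁻ z, ENNReal.ofReal (n ^ p) * ENNReal.ofReal ((1 - ‖z‖ ^ 2) ^ (p - 1) *
          ‖1 - (starRingEnd ℂ) a * z‖ ^ (-(((n + 1 : ℕ) : ℝ) * p))) ∂discArea := by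
          refine lintegral_mono_ae (ae_discArea_mem_unitDisc.mono fun z hz => ?_)
          have hz1 : ‖z‖ < 1 := mem_ball_zero_iff.1 hz
          have hz2 : 0 < 1 - ‖z‖ ^ 2 := by nlinarith [norm_nonneg z]
          have hn : ‖(n : ℂ) * (starRingEnd ℂ) a‖ₑ ^ p ≤ ENNReal.ofReal (n ^ p) := by
            rw [enorm_rpow_eq_ofReal hp.le, norm_mul, RCLike.norm_conj, Complex.norm_natCast]
            refine ENNReal.ofReal_le_ofReal (Real.rpow_le_rpow (by positivity) ?_ hp.le)
            exact mul_le_of_le_one_right (by positivity) ha.le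
          rw [(hasDerivAt_testFunction n ha hz).deriv, enorm_mul, ENNReal.mul_rpow_of_nonneg _ _ hp.le,
            enorm_testFunction_rpow hp.le, mul_assoc, ← ENNReal.ofReal_mul (by positivity),
            mul_comm (_ ^ (-(((n + 1 : ℕ) : ℝ) * p)))]
          gcongr
      _ ≤ _ := by
          rw [lintegral_const_mul' _ _ ENNReal.ofReal_ne_top]
          refine mul_le_mul_right ((h a ha).trans (le_of_eq ?_)) _
          push_cast
          ring_nf
  refine (add_le_add h1 h2).trans (le_of_eq ?_)
  rw [← ENNReal.ofReal_mul (by positivity), ← ENNReal.ofReal_add (by positivity) (by positivity)]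
  ring_nf

theorem exists_bergmanIntegral_testFunction_le {p q : ℝ} {n : ℕ} (hp : 0 < p) (hq : 0 < q)
    (hn : q + 1 < n * p) :
    ∃ C : ℝ, 0 < C ∧ ∀ a : ℂ, ‖a‖ < 1 → ∫⁻ z, ‖testFunction a n z‖ₑ ^ p *
      ENNReal.ofReal ((q - 1 + 1) * (1 - ‖z‖ ^ 2) ^ (q - 1)) ∂discArea
        ≤ ENNReal.ofReal (C * (1 - ‖a‖) ^ (q + 1 - n * p)) := by
  obtain ⟨C, hC, h⟩ := exists_lintegral_forelliRudin_le (c := q - 1) (t := n * p)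
    (by linarith) (by linarith)
  refine ⟨q * C, by positivity, fun a ha => ?_⟩
  calc _ = ∫⁻ z, ENNReal.ofReal q * ENNReal.ofReal ((1 - ‖z‖ ^ 2) ^ (q - 1) *
        ‖1 - (starRingEnd ℂ) a * z‖ ^ (-(n * p))) ∂discArea := by
        refine lintegral_congr fun z => ?_
        rw [enorm_testFunction_rpow hp.le, ← ENNReal.ofReal_mul (by positivity),
          ← ENNReal.ofReal_mul hq.le]
        ring_nf
    _ ≤ _ := by
        rw [lintegral_const_mul' _ _ ENNReal.ofReal_ne_top, mul_assoc, ENNReal.ofReal_mul hq.le]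
        refine mul_le_mul_right ((h a ha).trans (le_of_eq ?_)) _
        ring_nf

theorem ofReal_mul_measure_le_lintegral_testFunction {p : ℝ} {n : ℕ} (hp : 0 ≤ p) {a : ℂ}
    (ha : ‖a‖ < 1) {I : CircleArc}
    (h : ∀ z ∈ I.carlesonSquare, ‖1 - (starRingEnd ℂ) a * z‖ ≤ 5 * I.length)
    (μ : Measure unitDisc) :
    ENNReal.ofReal ((5 * I.length) ^ (-(n * p))) * μ I.carlesonSquare ≤
      ∫⁻ z in I.carlesonSquare, ‖testFunction a n z‖ₑ ^ p ∂μ := by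
  rw [← setLIntegral_const]
  refine setLIntegral_mono' I.measurableSet_carlesonSquare fun z hz => ?_
  rw [enorm_testFunction_rpow hp]
  refine ENNReal.ofReal_le_ofReal (Real.rpow_le_rpow_of_nonpos
    (norm_pos_iff.2 (one_sub_conj_mul_ne_zero ha z.2)) (h z hz) ?_)
  have : 0 ≤ n * p := by positivity
  linarith

/-- The powers of the length combine to `m + (s - m) + s'`, so the test exponent `m` drops out. The
tent space uses `s = 1`, `s' = q`; the Bergman space uses `s = q + 1`, `s' = 0`. -/
theorem isCarlesonMeasure_of_testing {μ : Measure unitDisc} {s s' m B : ℝ} {K : ℝ≥0∞} (hB : 0 ≤ B)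
    (hK : K ≠ ∞) (h : ∀ I : CircleArc,
      ENNReal.ofReal ((5 * I.length) ^ (-m)) * μ I.carlesonSquare ≤
        K * ENNReal.ofReal (B * (I.length / 2) ^ (s - m)) * ENNReal.ofReal (I.length ^ s')) :
    IsCarlesonMeasure (s' + s) μ := by
  refine isCarlesonMeasure_of_forall_le
    (ENNReal.mul_ne_top hK (ENNReal.ofReal_ne_top (r := 5 ^ m * B * 2 ^ (m - s)))) fun I => ?_
  have hl := I.length_pos
  calc μ I.carlesonSquare = ENNReal.ofReal ((5 * I.length) ^ m) *
        (ENNReal.ofReal ((5 * I.length) ^ (-m)) * μ I.carlesonSquare) := by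
        rw [← mul_assoc, ← ENNReal.ofReal_mul (by positivity), ← Real.rpow_add (by positivity),
          add_neg_cancel, Real.rpow_zero, ENNReal.ofReal_one, one_mul]
    _ ≤ ENNReal.ofReal ((5 * I.length) ^ m) * _ := mul_le_mul_right (h I) _
    _ = K * ENNReal.ofReal ((5 * I.length) ^ m * (B * (I.length / 2) ^ (s - m)) *
        I.length ^ s') := by
        rw [ENNReal.ofReal_mul (q := I.length ^ s') (by positivity),
          ENNReal.ofReal_mul (p := (5 * I.length) ^ m) (by positivity)]
        ring
    _ = _ := by
        rw [mul_assoc K, ← ENNReal.ofReal_mul (by positivity)]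
        congr 2
        have e : I.length ^ (s' + s) = I.length ^ m * I.length ^ (s - m) * I.length ^ s' := by
          rw [← Real.rpow_add hl, ← Real.rpow_add hl]; ring_nf
        have e2 : (2 : ℝ) ^ (m - s) = (2 ^ (s - m))⁻¹ := by
          rw [← Real.rpow_neg zero_le_two, neg_sub]
        rw [e, e2, Real.mul_rpow (by norm_num) hl.le, Real.div_rpow hl.le zero_le_two]
        ring

/-! ### From integral inequalities to bounded inclusions. -/

theorem ENNReal.rpow_one_div_le_mul_rpow_one_div {p : ℝ} (hp : 0 < p) {x y K : ℝ≥0∞}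
    (h : x ≤ K * y) : x ^ (1 / p) ≤ K ^ (1 / p) * y ^ (1 / p) := by
  rw [← ENNReal.mul_rpow_of_nonneg _ _ (by positivity)]
  exact ENNReal.rpow_le_rpow h (by positivity)

theorem ENNReal.le_rpow_mul_of_rpow_one_div_le {p : ℝ} (hp : 0 < p) {x y K : ℝ≥0∞}
    (h : x ^ (1 / p) ≤ K * y ^ (1 / p)) : x ≤ K ^ p * y := by
  have := ENNReal.rpow_le_rpow h hp.le
  rwa [ENNReal.mul_rpow_of_nonneg _ _ hp.le, ← ENNReal.rpow_mul, ← ENNReal.rpow_mul,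
    one_div_mul_cancel hp.ne', ENNReal.rpow_one, ENNReal.rpow_one] at this

theorem DifferentiableOn.aestronglyMeasurable_domRestrict {f : ℂ → ℂ}
    (hf : DifferentiableOn ℂ f unitDisc) (μ : Measure unitDisc) :
    AEStronglyMeasurable (unitDisc.domRestrict f) μ :=
  (hf.continuousOn.comp_continuous continuous_subtype_val
    fun z : unitDisc => z.2).aestronglyMeasurable

theorem eLpNorm_domRestrict {p : ℝ} (hp : 0 < p) (f : ℂ → ℂ) (μ : Measure unitDisc) :
    eLpNorm (unitDisc.domRestrict f) (ENNReal.ofReal p) μ = (∫⁻ z, ‖f z‖ₑ ^ p ∂μ) ^ (1 / p) := by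
  rw [eLpNorm_eq_lintegral_rpow_enorm_toReal (by simpa using hp) ENNReal.ofReal_ne_top,
    ENNReal.toReal_ofReal hp.le]
  rfl

theorem isBoundedInclusion_dirichletSpace_tentSpace {p q : ℝ} (hp : 0 < p) (hq : 0 < q)
    {μ : Measure unitDisc} (hμ : IsCarlesonMeasure (q + 1) μ) :
    IsBoundedInclusion (dirichletSpace p) (dirichletNorm p) (tentSpace p q μ) (tentNorm p q μ) := by
  obtain ⟨C, -, h⟩ := exists_lintegral_carlesonSquare_enorm_rpow_le hp hq
  have hK : (ENNReal.ofReal C * carlesonNorm (q + 1) μ) ^ (1 / p) ≠ ∞ :=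
    ENNReal.rpow_ne_top_of_nonneg (by positivity) (ENNReal.mul_ne_top ENNReal.ofReal_ne_top hμ.ne)
  refine ⟨((ENNReal.ofReal C * carlesonNorm (q + 1) μ) ^ (1 / p)).toNNReal, fun f hf => ?_⟩
  have hle : tentNorm p q μ (unitDisc.domRestrict f) ≤
      (ENNReal.ofReal C * carlesonNorm (q + 1) μ) ^ (1 / p) * dirichletNorm p f := by
    refine ENNReal.rpow_one_div_le_mul_rpow_one_div hp (iSup_le fun I => ?_)
    have hpos : 0 < I.length ^ q := Real.rpow_pos_of_pos I.length_pos q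
    rw [ENNReal.div_le_iff (by simpa using hpos) ENNReal.ofReal_ne_top]
    exact h μ hμ f hf.1 I
  refine ⟨⟨hf.1.aestronglyMeasurable_domRestrict μ, hle.trans_lt ?_⟩, ?_⟩
  · exact ENNReal.mul_lt_top hK.lt_top hf.2
  · rwa [ENNReal.coe_toNNReal hK]

theorem isBoundedInclusion_bergmanSpace_Lp {p q : ℝ} (hp : 0 < p) (hq : 0 < q)
    {μ : Measure unitDisc} (hμ : IsCarlesonMeasure (q + 1) μ) :
    IsBoundedInclusion (bergmanSpace p (q - 1)) (bergmanNorm p (q - 1))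
      {f | MemLp f (ENNReal.ofReal p) μ} (fun f => eLpNorm f (ENNReal.ofReal p) μ) := by
  obtain ⟨C, -, h⟩ := exists_lintegral_enorm_rpow_le hp hq
  have hK : (ENNReal.ofReal C * carlesonNorm (q + 1) μ) ^ (1 / p) ≠ ∞ :=
    ENNReal.rpow_ne_top_of_nonneg (by positivity) (ENNReal.mul_ne_top ENNReal.ofReal_ne_top hμ.ne)
  refine ⟨((ENNReal.ofReal C * carlesonNorm (q + 1) μ) ^ (1 / p)).toNNReal, fun f hf => ?_⟩
  have hle : eLpNorm (unitDisc.domRestrict f) (ENNReal.ofReal p) μ ≤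
      (ENNReal.ofReal C * carlesonNorm (q + 1) μ) ^ (1 / p) * bergmanNorm p (q - 1) f := by
    rw [eLpNorm_domRestrict hp]
    exact ENNReal.rpow_one_div_le_mul_rpow_one_div hp (h μ hμ f hf.1)
  refine ⟨⟨hf.1.aestronglyMeasurable_domRestrict μ, hle.trans_lt ?_⟩, ?_⟩
  · exact ENNReal.mul_lt_top hK.lt_top hf.2
  · rwa [ENNReal.coe_toNNReal hK]

theorem isCarlesonMeasure_of_isBoundedInclusion_tentSpace {p q : ℝ} (hp : 0 < p)
    {μ : Measure unitDisc} (h : IsBoundedInclusion (dirichletSpace p) (dirichletNorm p)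
      (tentSpace p q μ) (tentNorm p q μ)) : IsCarlesonMeasure (q + 1) μ := by
  obtain ⟨K, hK⟩ := h
  -- `n * p > 1` is the Forelli-Rudin threshold for the derivative of the test function.
  obtain ⟨n, hn⟩ := exists_nat_gt (1 / p)
  rw [div_lt_iff₀ hp] at hn
  obtain ⟨B, hB, hD⟩ := exists_dirichletIntegral_testFunction_le hp hn
  refine isCarlesonMeasure_of_testing (m := n * p) hB.le
    (ENNReal.rpow_ne_top_of_nonneg hp.le (ENNReal.coe_ne_top (r := K))) fun I => ?_
  obtain ⟨a, ha, haI⟩ := I.exists_norm_one_sub_conj_mul_le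
  have ha1 : ‖a‖ < 1 := by linarith [I.length_pos]
  have hDa := hD a ha1
  have hmem : testFunction a n ∈ dirichletSpace p :=
    ⟨differentiableOn_testFunction n ha1, ENNReal.rpow_lt_top_of_nonneg (by positivity)
      (hDa.trans_lt ENNReal.ofReal_lt_top).ne⟩
  have h1 := (le_iSup _ I).trans (ENNReal.le_rpow_mul_of_rpow_one_div_le hp (hK _ hmem).2)
  have hpos : 0 < I.length ^ q := Real.rpow_pos_of_pos I.length_pos q
  rw [ENNReal.div_le_iff (by simpa using hpos) ENNReal.ofReal_ne_top] at h1
  refine (ofReal_mul_measure_le_lintegral_testFunction hp.le ha1 haI μ).trans (h1.trans ?_)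
  have e : I.length / 2 = 1 - ‖a‖ := by rw [ha]; ring
  rw [e]
  gcongr

theorem isCarlesonMeasure_of_isBoundedInclusion_Lp {p q : ℝ} (hp : 0 < p) (hq : 0 < q)
    {μ : Measure unitDisc} (h : IsBoundedInclusion (bergmanSpace p (q - 1)) (bergmanNorm p (q - 1))
      {f | MemLp f (ENNReal.ofReal p) μ} (fun f => eLpNorm f (ENNReal.ofReal p) μ)) :
    IsCarlesonMeasure (q + 1) μ := by
  obtain ⟨K, hK⟩ := h
  obtain ⟨n, hn⟩ := exists_nat_gt ((q + 1) / p)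
  rw [div_lt_iff₀ hp] at hn
  obtain ⟨B, hB, hD⟩ := exists_bergmanIntegral_testFunction_le hp hq hn
  rw [← zero_add (q + 1)]
  refine isCarlesonMeasure_of_testing (m := n * p) hB.le
    (ENNReal.rpow_ne_top_of_nonneg hp.le (ENNReal.coe_ne_top (r := K))) fun I => ?_
  obtain ⟨a, ha, haI⟩ := I.exists_norm_one_sub_conj_mul_le
  have ha1 : ‖a‖ < 1 := by linarith [I.length_pos]
  have hDa := hD a ha1
  have hmem : testFunction a n ∈ bergmanSpace p (q - 1) :=
    ⟨differentiableOn_testFunction n ha1, ENNReal.rpow_lt_top_of_nonneg (by positivity)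
      (hDa.trans_lt ENNReal.ofReal_lt_top).ne⟩
  have h1 := (hK _ hmem).2
  simp only [eLpNorm_domRestrict hp] at h1
  have h2 := ENNReal.le_rpow_mul_of_rpow_one_div_le hp h1
  refine (ofReal_mul_measure_le_lintegral_testFunction hp.le ha1 haI μ).trans
    ((setLIntegral_le_lintegral _ _).trans (h2.trans ?_))
  have e : I.length / 2 = 1 - ‖a‖ := by rw [ha]; ring
  rw [e, Real.rpow_zero, ENNReal.ofReal_one, mul_one]
  gcongr

theorem mainTheorem1 (p q : ℝ) (hp : 0 < p) (hq : 0 < q) (μ : Measure unitDisc) :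
    List.TFAE [
      IsBoundedInclusion (dirichletSpace p) (dirichletNorm p) (tentSpace p q μ) (tentNorm p q μ),
      IsCarlesonMeasure (q + 1) μ,
      IsBoundedInclusion (bergmanSpace p (q - 1)) (bergmanNorm p (q - 1))
        {f | MemLp f (ENNReal.ofReal p) μ} (fun f => eLpNorm f (ENNReal.ofReal p) μ)] := by
  tfae_have 1 → 2 := isCarlesonMeasure_of_isBoundedInclusion_tentSpace hp
  tfae_have 2 → 1 := isBoundedInclusion_dirichletSpace_tentSpace hp hq
  tfae_have 2 → 3 := isBoundedInclusion_bergmanSpace_Lp hp hq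
  tfae_have 3 → 2 := isCarlesonMeasure_of_isBoundedInclusion_Lp hp hq
  tfae_finish
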